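/- Fix an integer $n\ge 1$, let $Ł_n=\{i/n : 0\le i\le n\}\subseteq[0,1]$, $\neg x=1-x$ and $x\to y=\min(1-x+y,1)$. Let $\Pi_0$ be a nonempty set of atomic programs and $\mathsf{Prop}$ a countably infinite set of propositional variables. Formulas and programs are given by $$\phi::=p\mid 0\mid\neg\phi\mid\phi\to\phi\mid[\alpha]\phi,\qquad \alpha::=a\mid\phi?\mid\alpha;\alpha\mid\alpha\cup\alpha\mid\alpha^*\qquad(p\in\mathsf{Prop},\ a\in\Pi_0).$$ Write $1=\neg 0$, $\phi\vee\psi=(\phi\to\psi)\to\psi$, $\phi\wedge\psi=\neg(\neg\phi\vee\neg\psi)$, $\phi\oplus\psi=\neg\phi\to\psi$, $\phi\odot\psi=\neg(\neg\phi\oplus\neg\psi)$, $\phi\leftrightarrow\psi=(\phi\to\psi)\odot(\psi\to\phi)$, and $\phi^k=\phi\odot\cdots\odot\phi$ ($k$ factors, $\phi^0=1$). An $(n+1)$-valued Kripke model consists of a nonempty set $W$, a relation $R_a\subseteq W\times W$ for each $a\in\Pi_0$ and a map $\mathrm{Val}:W\times\mathsf{Prop}\to Ł_n$. These are extended to all programs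 and formulas by: $R_{\alpha;\beta}=R_\alpha\circ R_\beta$ (first $\alpha$, then $\beta$); $R_{\alpha\cup\beta}=R_\alpha\cup R_\beta$; $R_{\psi?}=\{(u,u):\mathrm{Val}(u,\psi)=1\}$; $R_{\alpha^*}$ is the reflexive and transitive closure of $R_\alpha$; $\mathrm{Val}(w,0)=0$; $\mathrm{Val}(w,\neg\phi)=\neg\mathrm{Val}(w,\phi)$; $\mathrm{Val}(w,\phi\to\psi)=\mathrm{Val}(w,\phi)\to\mathrm{Val}(w,\psi)$; and $\mathrm{Val}(w,[\alpha]\phi)=\bigwedge\{\mathrm{Val}(v,\phi):(w,v)\in R_\alpha\}$ (infimum in $[0,1]$, so $1$ if there is no successor). A formula is a tautology if it has value $1$ in every world of every $(n+1)$-valued Kripke model. An $(n+1)$-valued propositional dynamic logic is a set of formulas closed under modus ponens, uniform substitution (of formulas for propositional variables, also inside tests) and necessitation ($\phi/[\alpha]\phi$ for every program $\alpha$), and containing: all tautologies of $(n+1)$-valued Łukasiewicz logic (the formulas built from variables and $0$ with $\neg$ and $\to$ that have value $1$ under all assignments in $Ł_n$); and, for all programs $\alpha,\beta$ and variables $p,q$,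 the formulas $[\alpha](p\to q)\to([\alpha]p\to[\alpha]q)$; $[\alpha](p\oplus p)\leftrightarrow[\alpha]p\oplus[\alpha]p$; $[\alpha](p\odot p)\leftrightarrow[\alpha]p\odot[\alpha]p$; $[\alpha\cup\beta]p\leftrightarrow[\alpha]p\wedge[\beta]p$; $[\alpha;\beta]p\leftrightarrow[\alpha][\beta]p$; $[q?]p\leftrightarrow(\neg (q^n)\vee p)$; $[\alpha^*]p\leftrightarrow(p\wedge[\alpha][\alpha^*]p)$; $[\alpha^*]p\to[\alpha^*][\alpha^*]p$; $(p\wedge[\alpha^*](p\to[\alpha]p)^n)\to[\alpha^*]p$. Let $\mathrm{PDL}_n$ be the smallest such logic. Theorem. $\mathrm{PDL}_n$ is (sound and) complete with respect to the $(n+1)$-valued Kripke models: a formula belongs to $\mathrm{PDL}_n$ if and only if it is a tautology. -/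

import Mathlib

universe u v w

namespace ManyValuedPDL

open scoped unitInterval

/-! ### Łukasiewicz operations on the real unit interval and the finite chains -/

/-- Łukasiewicz negation `1 - x` on `[0,1]`. -/
def lukNeg (x : I) : I :=
  ⟨1 - (x : ℝ), by linarith [x.2.2], by linarith [x.2.1]⟩

/-- Łukasiewicz implication `min (1 - x + y) 1` on `[0,1]`. -/
noncomputable def lukImp (x y : I) : I :=
  ⟨min (1 - (x : ℝ) + (y : ℝ)) 1,
    le_min (by linarith [x.2.2, y.2.1]) zero_le_one, min_le_right _ _⟩

/-- The finite chain of truth values `i / n`, `0 ≤ i ≤ n`. -/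
def Luk (n : ℕ) : Set I :=
  {x | ∃ i : ℕ, i ≤ n ∧ (x : ℝ) = (i : ℝ) / (n : ℝ)}

/-! ### Syntax -/

mutual
  /-- Formulas: `p`, `0`, `¬ φ`, `φ → ψ`, `[α] φ`. -/
  inductive Form (Atm : Type u) (Var : Type v) : Type (max u v)
    | var : Var → Form Atm Var
    | zero : Form Atm Var
    | neg : Form Atm Var → Form Atm Var
    | imp : Form Atm Var → Form Atm Var → Form Atm Var
    | box : Prog Atm Var → Form Atm Var → Form Atm Var
  /-- Programs: `a`, `φ?`, `α ; β`, `α ∪ β`, `α*`. -/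
  inductive Prog (Atm : Type u) (Var : Type v) : Type (max u v)
    | atom : Atm → Prog Atm Var
    | test : Form Atm Var → Prog Atm Var
    | seq : Prog Atm Var → Prog Atm Var → Prog Atm Var
    | union : Prog Atm Var → Prog Atm Var → Prog Atm Var
    | star : Prog Atm Var → Prog Atm Var
end

namespace Form

variable {Atm : Type u} {Var : Type v}

/-- The formula `1`. -/
def one : Form Atm Var := neg zero

/-- `φ ∨ ψ := (φ → ψ) → ψ`. -/
def or (φ ψ : Form Atm Var) : Form Atm Var := imp (imp φ ψ) ψ

/-- `φ ∧ ψ := ¬ (¬ φ ∨ ¬ ψ)`. -/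
def and (φ ψ : Form Atm Var) : Form Atm Var := neg (or (neg φ) (neg ψ))

/-- Strong disjunction `φ ⊕ ψ := ¬ φ → ψ`. -/
def oplus (φ ψ : Form Atm Var) : Form Atm Var := imp (neg φ) ψ

/-- Strong conjunction `φ ⊙ ψ := ¬ (¬ φ ⊕ ¬ ψ)`. -/
def odot (φ ψ : Form Atm Var) : Form Atm Var := neg (oplus (neg φ) (neg ψ))

/-- `φ ↔ ψ := (φ → ψ) ⊙ (ψ → φ)`. -/
def iff (φ ψ : Form Atm Var) : Form Atm Var := odot (imp φ ψ) (imp ψ φ)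

/-- `φ ^ k := φ ⊙ ⋯ ⊙ φ`, with `k` factors, and `φ ^ 0 := 1`. -/
def pow (φ : Form Atm Var) : ℕ → Form Atm Var
  | 0 => one
  | 1 => φ
  | k + 2 => odot (pow φ (k + 1)) φ

end Form

mutual
  /-- Uniform substitution of formulas for propositional variables in a formula. -/
  def Form.subst {Atm : Type u} {Var : Type v} (s : Var → Form Atm Var) :
      Form Atm Var → Form Atm Var
    | .var p => s p
    | .zero => .zero
    | .neg φ => .neg (φ.subst s)
    | .imp φ ψ => .imp (φ.subst s) (ψ.subst s)
    | .box α φ => .box (α.subst s) (φ.subst s)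
  /-- Uniform substitution inside a program: it acts on the formulas that are tested. -/
  def Prog.subst {Atm : Type u} {Var : Type v} (s : Var → Form Atm Var) :
      Prog Atm Var → Prog Atm Var
    | .atom a => .atom a
    | .test φ => .test (φ.subst s)
    | .seq α β => .seq (α.subst s) (β.subst s)
    | .union α β => .union (α.subst s) (β.subst s)
    | .star α => .star (α.subst s)
end

/-! ### Kripke models -/

/-- An `n+1`-valued Kripke model: a nonempty set of worlds, a crisp relation for each atomic
program, and a valuation of the propositional variables in the chain `Luk n`. -/
structure KripkeModel (n : ℕ) (Atm : Type u) (Var : Type v) where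
  /-- The worlds. -/
  World : Type w
  nonempty : Nonempty World
  /-- The relations of the atomic programs. -/
  rel : Atm → World → World → Prop
  /-- The values of the propositional variables. -/
  valuation : World → Var → I
  valuation_mem : ∀ x p, valuation x p ∈ Luk n

mutual
  /-- The truth value of a formula in a world; the value of `[α] φ` is the infimum, in the
  complete lattice `[0,1]`, of the values of `φ` in the `α`-successors (`1` if there is none). -/
  noncomputable def KripkeModel.val {n : ℕ} {Atm : Type u} {Var : Type v}
      (M : KripkeModel.{u, v, w} n Atm Var) : Form Atm Var → M.World → I
    | .var p => fun x => M.valuation x p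
    | .zero => fun _ => 0
    | .neg φ => fun x => lukNeg (M.val φ x)
    | .imp φ ψ => fun x => lukImp (M.val φ x) (M.val ψ x)
    | .box α φ => fun x => sInf {t : I | ∃ y, M.progRel α x y ∧ M.val φ y = t}
  /-- The relation of a program. -/
  noncomputable def KripkeModel.progRel {n : ℕ} {Atm : Type u} {Var : Type v}
      (M : KripkeModel.{u, v, w} n Atm Var) : Prog Atm Var → M.World → M.World → Prop
    | .atom a => M.rel a
    | .test φ => fun x y => x = y ∧ M.val φ x = 1
    | .seq α β => Relation.Comp (M.progRel α) (M.progRel β)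
    | .union α β => fun x y => M.progRel α x y ∨ M.progRel β x y
    | .star α => Relation.ReflTransGen (M.progRel α)
end

/-- A formula is a tautology if it has value `1` in every world of every `n+1`-valued
Kripke model. -/
def IsTautology (n : ℕ) {Atm : Type u} {Var : Type v} (φ : Form Atm Var) : Prop :=
  ∀ (M : KripkeModel.{u, v, w} n Atm Var) (x : M.World), M.val φ x = 1

/-! ### The `n+1`-valued Łukasiewicz logic -/

/-- Formulas built from variables and `0` with `¬` and `→` only. -/
inductive LukForm (Var : Type v) : Type v
  | var : Var → LukForm Var
  | zero : LukForm Var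
  | neg : LukForm Var → LukForm Var
  | imp : LukForm Var → LukForm Var → LukForm Var

namespace LukForm

variable {Var : Type v}

/-- The `[0,1]`-interpretation. -/
noncomputable def eval (e : Var → I) : LukForm Var → I
  | var p => e p
  | zero => 0
  | neg τ => lukNeg (τ.eval e)
  | imp τ ρ => lukImp (τ.eval e) (ρ.eval e)

/-- Tautologies of the `n+1`-valued Łukasiewicz logic. -/
def IsTautology (n : ℕ) (τ : LukForm Var) : Prop :=
  ∀ e : Var → I, (∀ p, e p ∈ Luk n) → τ.eval e = 1

/-- A Łukasiewicz formula, seen as a formula of the dynamic language. -/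
def toForm (Atm : Type u) : LukForm Var → Form Atm Var
  | var p => .var p
  | zero => .zero
  | neg τ => .neg (τ.toForm Atm)
  | imp τ ρ => .imp (τ.toForm Atm) (ρ.toForm Atm)

end LukForm

/-! ### The deductive systems -/

/-- The modal, program and induction axioms of `n+1`-valued propositional dynamic logic.
The letters `p`, `q` are propositional variables, and `α`, `β` are arbitrary programs. -/
inductive IsAxiom (n : ℕ) {Atm : Type u} {Var : Type v} : Form Atm Var → Prop
  /-- `[α](p → q) → ([α]p → [α]q)`. -/
  | K (α : Prog Atm Var) (p q : Var) :
      IsAxiom n (.imp (.box α (.imp (.var p) (.var q)))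
        (.imp (.box α (.var p)) (.box α (.var q))))
  /-- `[α](p ⊕ p) ↔ [α]p ⊕ [α]p`. -/
  | box_oplus (α : Prog Atm Var) (p : Var) :
      IsAxiom n (.iff (.box α (.oplus (.var p) (.var p)))
        (.oplus (.box α (.var p)) (.box α (.var p))))
  /-- `[α](p ⊙ p) ↔ [α]p ⊙ [α]p`. -/
  | box_odot (α : Prog Atm Var) (p : Var) :
      IsAxiom n (.iff (.box α (.odot (.var p) (.var p)))
        (.odot (.box α (.var p)) (.box α (.var p))))
  /-- `[α ∪ β]p ↔ [α]p ∧ [β]p`. -/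
  | union (α β : Prog Atm Var) (p : Var) :
      IsAxiom n (.iff (.box (.union α β) (.var p))
        (.and (.box α (.var p)) (.box β (.var p))))
  /-- `[α ; β]p ↔ [α][β]p`. -/
  | seq (α β : Prog Atm Var) (p : Var) :
      IsAxiom n (.iff (.box (.seq α β) (.var p)) (.box α (.box β (.var p))))
  /-- `[q?]p ↔ (¬ q ^ n ∨ p)`. -/
  | test (p q : Var) :
      IsAxiom n (.iff (.box (.test (.var q)) (.var p))
        (.or (.neg (.pow (.var q) n)) (.var p)))
  /-- `[α*]p ↔ (p ∧ [α][α*]p)`. -/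
  | star_unfold (α : Prog Atm Var) (p : Var) :
      IsAxiom n (.iff (.box (.star α) (.var p))
        (.and (.var p) (.box α (.box (.star α) (.var p)))))
  /-- `[α*]p → [α*][α*]p`. -/
  | star_trans (α : Prog Atm Var) (p : Var) :
      IsAxiom n (.imp (.box (.star α) (.var p))
        (.box (.star α) (.box (.star α) (.var p))))
  /-- `(p ∧ [α*](p → [α]p) ^ n) → [α*]p`. -/
  | induction (α : Prog Atm Var) (p : Var) :
      IsAxiom n (.imp
        (.and (.var p)
          (.box (.star α) (.pow (.imp (.var p) (.box α (.var p))) n)))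
        (.box (.star α) (.var p)))

/-- An `n+1`-valued propositional dynamic logic: a set of formulas that contains the axioms
and is closed under modus ponens, uniform substitution and necessitation. -/
structure IsDynamicLogic (n : ℕ) {Atm : Type u} {Var : Type v}
    (L : Set (Form Atm Var)) : Prop where
  luk_mem : ∀ τ : LukForm Var, τ.IsTautology n → τ.toForm Atm ∈ L
  ax_mem : ∀ φ : Form Atm Var, IsAxiom n φ → φ ∈ L
  modus_ponens : ∀ φ ψ : Form Atm Var, φ ∈ L → Form.imp φ ψ ∈ L → ψ ∈ L
  substitution : ∀ (φ : Form Atm Var) (s : Var → Form Atm Var), φ ∈ L → φ.subst s ∈ L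
  necessitation : ∀ (φ : Form Atm Var) (α : Prog Atm Var), φ ∈ L → Form.box α φ ∈ L

/-- The smallest `n+1`-valued propositional dynamic logic, as the intersection of all of
them. -/
def PDL (n : ℕ) (Atm : Type u) (Var : Type v) : Set (Form Atm Var) :=
  ⋂₀ {L | IsDynamicLogic n L}

/-- The intersection of all the logics is a logic, and it is the smallest one. -/
theorem PDL_isLeast (n : ℕ) (Atm : Type u) (Var : Type v) :
    IsLeast {L : Set (Form Atm Var) | IsDynamicLogic n L} (PDL n Atm Var) := by
  refine ⟨?_, fun L hL => Set.sInter_subset_of_mem hL⟩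
  constructor
  · exact fun τ hτ L hL => IsDynamicLogic.luk_mem hL τ hτ
  · exact fun φ hφ L hL => IsDynamicLogic.ax_mem hL φ hφ
  · exact fun φ ψ h1 h2 L hL =>
      IsDynamicLogic.modus_ponens hL φ ψ (h1 L hL) (h2 L hL)
  · exact fun φ s h L hL => IsDynamicLogic.substitution hL φ s (h L hL)
  · exact fun φ α h L hL => IsDynamicLogic.necessitation hL φ α (h L hL)

end ManyValuedPDL

namespace ManyValuedPDL

open scoped unitInterval

/-! ### The chain of truth values -/

-- Soundness: the tautologies form a dynamic logic, and `PDL` is the least one. Values lie in a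
-- finite chain, so the infimum defining a box is attained whenever there is a successor.
--
-- Completeness goes through canonical worlds, the valuations in the chain that give every theorem
-- the value 1. By compactness and a deduction theorem with n-fold premises, a formula with value 1
-- in all of them is a theorem (`mem_PDL_iff`). The many-valued problem becomes two-valued through
-- threshold operators: for each t > 0 some composition of x ⊕ x and x ⊙ x is the characteristic
-- function of {x | t ≤ x}, and the axioms for [α](p ⊕ p) and [α](p ⊙ p) make it commute with boxes.
--
-- The canonical relation of α* need not be the reflexive transitive closure of that of α, so the
-- canonical worlds are filtrated through a finite Fischer–Ladner closure Γ. Every set of points of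
-- the quotient has a 0-1-valued characteristic formula, again by thresholds. Two facts, proved
-- together with the truth lemma `val_model`, tie the quotient to the canonical worlds: canonical
-- successors are successors in the quotient (`progRel_of_rel`, where the induction axiom is applied
-- to the characteristic formula of the reachable points), and successors in the quotient respect
-- the boxes of Γ (`val_box_le_of_progRel`).

theorem coe_lukNeg (x : I) : (lukNeg x : ℝ) = 1 - x := rfl

theorem coe_lukImp (x y : I) : (lukImp x y : ℝ) = min (1 - (x : ℝ) + y) 1 := rfl

theorem zero_mem_Luk (n : ℕ) : (0 : I) ∈ Luk n := ⟨0, Nat.zero_le _, by simp⟩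

theorem one_mem_Luk {n : ℕ} (hn : 1 ≤ n) : (1 : I) ∈ Luk n :=
  ⟨n, le_rfl, by
    have : (n : ℝ) ≠ 0 := by positivity
    simp [this]⟩

theorem lukNeg_mem_Luk {n : ℕ} (hn : 1 ≤ n) {x : I} (hx : x ∈ Luk n) : lukNeg x ∈ Luk n := by
  obtain ⟨i, hi, hx⟩ := hx
  refine ⟨n - i, Nat.sub_le _ _, ?_⟩
  have : (n : ℝ) ≠ 0 := by positivity
  rw [coe_lukNeg, hx, Nat.cast_sub hi]
  field_simp

theorem lukImp_mem_Luk {n : ℕ} (hn : 1 ≤ n) {x y : I} (hx : x ∈ Luk n) (hy : y ∈ Luk n) :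
    lukImp x y ∈ Luk n := by
  obtain ⟨i, hi, hx⟩ := hx
  obtain ⟨j, hj, hy⟩ := hy
  have hn0 : (0 : ℝ) < n := by positivity
  rcases le_total i j with hij | hij
  · refine ⟨n, le_rfl, ?_⟩
    have : (i : ℝ) / n ≤ j / n := by gcongr
    rw [coe_lukImp, hx, hy, min_eq_right (by linarith), div_self hn0.ne']
  · refine ⟨n - i + j, by omega, ?_⟩
    have : (j : ℝ) / n ≤ i / n := by gcongr
    rw [coe_lukImp, hx, hy, min_eq_left (by linarith), Nat.cast_add, Nat.cast_sub hi]
    field_simp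

theorem finite_Luk (n : ℕ) : (Luk n).Finite := by
  have : ((fun x : I => (x : ℝ)) '' Luk n).Finite := by
    refine ((Set.finite_Iic n).image fun i : ℕ => (i : ℝ) / n).subset ?_
    rintro _ ⟨x, ⟨i, hi, hx⟩, rfl⟩
    exact ⟨i, hi, hx.symm⟩
  exact this.of_finite_image Subtype.val_injective.injOn

/-- Distinct truth values differ by at least `1 / n`. -/
theorem add_le_of_lt_of_mem_Luk {n : ℕ} (hn : 1 ≤ n) {x y : I} (hx : x ∈ Luk n) (hy : y ∈ Luk n)
    (h : x < y) : (x : ℝ) + 1 / n ≤ y := by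
  obtain ⟨i, hi, hx⟩ := hx
  obtain ⟨j, hj, hy⟩ := hy
  have hn0 : (0 : ℝ) < n := by positivity
  have h' : (x : ℝ) < y := h
  rw [hx, hy, div_lt_div_iff_of_pos_right hn0, Nat.cast_lt] at h'
  have : ((i : ℝ) + 1) ≤ j := by exact_mod_cast h'
  rw [hx, hy, ← add_div]
  gcongr

theorem le_of_lt_one_of_mem_Luk {n : ℕ} (hn : 1 ≤ n) {x : I} (hx : x ∈ Luk n) (h : x ≠ 1) :
    (x : ℝ) ≤ 1 - 1 / n := by
  have := add_le_of_lt_of_mem_Luk hn hx (one_mem_Luk hn) (lt_of_le_of_ne x.2.2 h)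
  simp only [Set.Icc.coe_one] at this
  linarith

/-! ### Valuations -/

variable {Atm : Type u} {Var : Type v} {n : ℕ}

/-- A map from formulas to the chain `Luk n` that respects the Łukasiewicz connectives. -/
structure IsValuation (n : ℕ) (e : Form Atm Var → I) : Prop where
  mem : ∀ φ, e φ ∈ Luk n
  zero : e .zero = 0
  neg : ∀ φ, e (.neg φ) = lukNeg (e φ)
  imp : ∀ φ ψ, e (.imp φ ψ) = lukImp (e φ) (e ψ)

namespace IsValuation

variable {e : Form Atm Var → I}

theorem coe_neg (he : IsValuation n e) (φ : Form Atm Var) : (e φ.neg : ℝ) = 1 - e φ := by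
  rw [he.neg, coe_lukNeg]

theorem coe_imp (he : IsValuation n e) (φ ψ : Form Atm Var) :
    (e (φ.imp ψ) : ℝ) = min (1 - (e φ : ℝ) + e ψ) 1 := by
  rw [he.imp, coe_lukImp]

theorem imp_eq_one (he : IsValuation n e) {φ ψ : Form Atm Var} :
    e (φ.imp ψ) = 1 ↔ e φ ≤ e ψ := by
  rw [← Subtype.coe_inj, ← Subtype.coe_le_coe, he.coe_imp, Set.Icc.coe_one, min_eq_right_iff]
  constructor <;> intro h <;> linarith

theorem apply_one (he : IsValuation n e) : e .one = 1 := by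
  rw [Form.one, ← Subtype.coe_inj, he.coe_neg, he.zero]
  simp

theorem coe_or (he : IsValuation n e) (φ ψ : Form Atm Var) :
    (e (φ.or ψ) : ℝ) = max (e φ : ℝ) (e ψ) := by
  rw [Form.or, he.coe_imp, he.coe_imp]
  have := (e φ).2.2
  have := (e ψ).2.2
  grind

theorem coe_and (he : IsValuation n e) (φ ψ : Form Atm Var) :
    (e (φ.and ψ) : ℝ) = min (e φ : ℝ) (e ψ) := by
  rw [Form.and, he.coe_neg, he.coe_or, he.coe_neg, he.coe_neg]
  grind

theorem apply_and (he : IsValuation n e) (φ ψ : Form Atm Var) :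
    e (φ.and ψ) = min (e φ) (e ψ) := by
  refine Subtype.ext ?_
  rw [he.coe_and]
  exact ((Subtype.mono_coe (· ∈ I)).map_min).symm

theorem coe_oplus (he : IsValuation n e) (φ ψ : Form Atm Var) :
    (e (φ.oplus ψ) : ℝ) = min ((e φ : ℝ) + e ψ) 1 := by
  rw [Form.oplus, he.coe_imp, he.coe_neg]
  ring_nf

theorem coe_odot (he : IsValuation n e) (φ ψ : Form Atm Var) :
    (e (φ.odot ψ) : ℝ) = max ((e φ : ℝ) + e ψ - 1) 0 := by
  rw [Form.odot, he.coe_neg, he.coe_oplus, he.coe_neg, he.coe_neg]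
  grind

theorem iff_eq_one (he : IsValuation n e) {φ ψ : Form Atm Var} :
    e (φ.iff ψ) = 1 ↔ e φ = e ψ := by
  rw [Form.iff, ← Subtype.coe_inj, ← Subtype.coe_inj, he.coe_odot, he.coe_imp, he.coe_imp,
    Set.Icc.coe_one]
  grind

theorem coe_pow (he : IsValuation n e) (φ : Form Atm Var) (k : ℕ) :
    (e (φ.pow k) : ℝ) = max (1 - k * (1 - (e φ : ℝ))) 0 := by
  have h1 := (e φ).2.2
  have h0 := (e φ).2.1
  induction k with
  | zero => simp [Form.pow, he.apply_one]
  | succ k ih =>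
    cases k with
    | zero => simp [Form.pow, h0]
    | succ k =>
      rw [Form.pow, he.coe_odot, ih]
      push_cast
      grind

theorem pow_eq_one (he : IsValuation n e) {φ : Form Atm Var} (k : ℕ) (h : e φ = 1) :
    e (φ.pow k) = 1 := by
  rw [← Subtype.coe_inj, he.coe_pow, h]
  simp

/-- A value below 1 misses it by at least 1/n, so n factors lose at least 1. Hence the n-th power is
two-valued, which is its role in the test and induction axioms. -/
theorem pow_eq_zero (hn : 1 ≤ n) (he : IsValuation n e) {φ : Form Atm Var} (h : e φ ≠ 1) :
    e (φ.pow n) = 0 := by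
  have := le_of_lt_one_of_mem_Luk hn (he.mem φ) h
  have hn0 : (0 : ℝ) < n := by positivity
  rw [← Subtype.coe_inj, he.coe_pow, Set.Icc.coe_zero, max_eq_right_iff]
  have : (n : ℝ) * (1 / n) ≤ n * (1 - (e φ : ℝ)) := by
    gcongr
    linarith
  rw [mul_one_div_cancel hn0.ne'] at this
  linarith

/-- An `n`-fold premise acts classically: it only matters when its value is `1`. -/
theorem imp_iterate_eq_one (hn : 1 ≤ n) (he : IsValuation n e) {φ ψ : Form Atm Var}
    (h : e φ = 1 → e ψ = 1) : e ((Form.imp φ)^[n] ψ) = 1 := by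
  have key : ∀ k : ℕ, (e ((Form.imp φ)^[k] ψ) : ℝ) = min (k * (1 - (e φ : ℝ)) + e ψ) 1 := by
    have h1 := (e φ).2.2
    have h2 := (e ψ).2.2
    intro k
    induction k with
    | zero => simp [h2]
    | succ k ih =>
      rw [Function.iterate_succ_apply', he.coe_imp, ih]
      push_cast
      grind
  rw [← Subtype.coe_inj, key, Set.Icc.coe_one, min_eq_right_iff]
  by_cases h1 : e φ = 1
  · simp [h1, h h1]
  -- Each premise adds the deficit 1 - e φ ≥ 1/n, so n of them already reach 1.
  · have := le_of_lt_one_of_mem_Luk hn (he.mem φ) h1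
    have hn0 : (0 : ℝ) < n := by positivity
    have : (n : ℝ) * (1 / n) ≤ n * (1 - (e φ : ℝ)) := by
      gcongr
      linarith
    rw [mul_one_div_cancel hn0.ne'] at this
    linarith [(e ψ).2.1]

end IsValuation

-- Threshold operators

/-- Dyadic affine maps with slope `2 ^ m`, truncated to `[0,1]`, are compositions of
`x ⊕ x` and `x ⊙ x`; they commute with every map that commutes with these two. -/
theorem exists_dyadic_operator (m k : ℕ) (hk : k < 2 ^ m) :
    ∃ τ : Form Atm Var → Form Atm Var,
      (∀ (n : ℕ) (e : Form Atm Var → I), IsValuation n e → ∀ ψ,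
        (e (τ ψ) : ℝ) = max 0 (min 1 (2 ^ m * (e ψ : ℝ) - k))) ∧
      ∀ (n : ℕ) (e : Form Atm Var → I) (f : Form Atm Var → Form Atm Var), IsValuation n e →
        (∀ ψ, e (f (ψ.oplus ψ)) = e ((f ψ).oplus (f ψ))) →
        (∀ ψ, e (f (ψ.odot ψ)) = e ((f ψ).odot (f ψ))) →
        ∀ ψ, e (f (τ ψ)) = e (τ (f ψ)) := by
  induction m generalizing k with
  | zero =>
    obtain rfl : k = 0 := by simpa using hk
    refine ⟨id, fun n e he ψ => ?_, fun _ _ _ _ _ _ _ => rfl⟩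
    have h0 := (e ψ).2.1
    have h1 := (e ψ).2.2
    simp [h0, h1]
  | succ m ih =>
    rw [pow_succ] at hk
    -- The last binary digit of k selects the outer connective: ⊕ doubles the map, ⊙ doubles it and
    -- subtracts 1.
    obtain ⟨τ, h1, h2⟩ := ih (k / 2) (by omega)
    rcases Nat.even_or_odd' k with ⟨l, rfl | rfl⟩
    · refine ⟨fun ψ => (τ ψ).oplus (τ ψ), fun n e he ψ => ?_, fun n e f he ho hd ψ => ?_⟩
      · rw [he.coe_oplus, h1 n e he, Nat.mul_div_cancel_left _ two_pos, pow_succ]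
        push_cast
        grind
      · rw [ho, ← Subtype.coe_inj, he.coe_oplus, he.coe_oplus, h2 n e f he ho hd]
    · refine ⟨fun ψ => (τ ψ).odot (τ ψ), fun n e he ψ => ?_, fun n e f he ho hd ψ => ?_⟩
      · have : (2 * l + 1) / 2 = l := by omega
        rw [he.coe_odot, h1 n e he, this, pow_succ]
        push_cast
        grind
      · rw [hd, ← Subtype.coe_inj, he.coe_odot, he.coe_odot, h2 n e f he ho hd]

/-- For each truth value `t > 0` a composition of `x ⊕ x` and `x ⊙ x` is the characteristic
function of `{x | t ≤ x}`. -/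
theorem exists_threshold_operator (hn : 1 ≤ n) {t : I} (ht : t ∈ Luk n) (ht0 : t ≠ 0) :
    ∃ τ : Form Atm Var → Form Atm Var,
      (∀ e : Form Atm Var → I, IsValuation n e → ∀ ψ,
        (t ≤ e ψ → e (τ ψ) = 1) ∧ (e ψ < t → e (τ ψ) = 0)) ∧
      ∀ (e : Form Atm Var → I) (f : Form Atm Var → Form Atm Var), IsValuation n e →
        (∀ ψ, e (f (ψ.oplus ψ)) = e ((f ψ).oplus (f ψ))) →
        (∀ ψ, e (f (ψ.odot ψ)) = e ((f ψ).odot (f ψ))) →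
        ∀ ψ, e (f (τ ψ)) = e (τ (f ψ)) := by
  have hn0 : (0 : ℝ) < n := by positivity
  -- The map must be at most 0 at t - 1/n and at least 1 at t, so an integer k is needed between 2^m
  -- (t - 1/n) and 2^m t - 1. With 2^m > 2n this interval is longer than 1, and the ceiling of its
  -- left end will do.
  obtain ⟨m, hm⟩ := pow_unbounded_of_one_lt (2 * n : ℝ) (one_lt_two)
  have htn : (1 : ℝ) / n ≤ t := by
    have := add_le_of_lt_of_mem_Luk hn (zero_mem_Luk n) ht (lt_of_le_of_ne t.2.1 (Ne.symm ht0))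
    simpa using this
  have h2m : (0 : ℝ) < 2 ^ m := by positivity
  have hgap : (2 : ℝ) < 2 ^ m * (1 / n) := by
    rw [mul_one_div, lt_div_iff₀ hn0]
    exact hm
  have hk1 := Nat.le_ceil ((2 : ℝ) ^ m * (t - 1 / n))
  have hk2 := Nat.ceil_lt_add_one (a := (2 : ℝ) ^ m * (t - 1 / n))
    (mul_nonneg h2m.le (by linarith))
  set k := ⌈(2 : ℝ) ^ m * (t - 1 / n)⌉₊
  have hk3 : (k : ℝ) + 1 ≤ 2 ^ m * t := by linarith
  have hk : k < 2 ^ m := by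
    have : (2 : ℝ) ^ m * t ≤ 2 ^ m * 1 := by
      gcongr
      exact t.2.2
    have : (k : ℝ) < (2 ^ m : ℕ) := by
      push_cast
      linarith
    exact_mod_cast this
  obtain ⟨τ, h1, h2⟩ := exists_dyadic_operator (Atm := Atm) (Var := Var) m k hk
  refine ⟨τ, fun e he ψ => ⟨fun h => ?_, fun h => ?_⟩, fun e f => h2 n e f⟩
  · have h' : (2 : ℝ) ^ m * t ≤ 2 ^ m * e ψ := by
      gcongr
    rw [← Subtype.coe_inj, h1 n e he, Set.Icc.coe_one, min_eq_left (by linarith),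
      max_eq_right zero_le_one]
  · have := add_le_of_lt_of_mem_Luk hn (he.mem ψ) ht h
    have h' : (2 : ℝ) ^ m * e ψ ≤ 2 ^ m * (t - 1 / n) := by
      gcongr
      linarith
    rw [← Subtype.coe_inj, h1 n e he, Set.Icc.coe_zero, max_eq_left]
    exact (min_le_right _ _).trans (by linarith)

/-! ### Soundness -/

section Soundness

variable (M : KripkeModel.{u, v, w} n Atm Var)

theorem KripkeModel.val_box (α : Prog Atm Var) (φ : Form Atm Var) (x : M.World) :
    M.val (.box α φ) x = sInf {t : I | ∃ y, M.progRel α x y ∧ M.val φ y = t} := by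
  rw [KripkeModel.val]

theorem KripkeModel.le_val_box {α : Prog Atm Var} {φ : Form Atm Var} {x : M.World} {t : I} :
    t ≤ M.val (.box α φ) x ↔ ∀ y, M.progRel α x y → t ≤ M.val φ y := by
  rw [M.val_box, le_sInf_iff]
  constructor
  · exact fun h y hy => h _ ⟨y, hy, rfl⟩
  · rintro h _ ⟨y, hy, rfl⟩
    exact h y hy

theorem KripkeModel.val_mem (hn : 1 ≤ n) : ∀ (φ : Form Atm Var) (x : M.World), M.val φ x ∈ Luk n
  | .var p, x => by rw [KripkeModel.val]; exact M.valuation_mem x p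
  | .zero, x => by rw [KripkeModel.val]; exact zero_mem_Luk n
  | .neg φ, x => by rw [KripkeModel.val]; exact lukNeg_mem_Luk hn (val_mem hn φ x)
  | .imp φ ψ, x => by
    rw [KripkeModel.val]; exact lukImp_mem_Luk hn (val_mem hn φ x) (val_mem hn ψ x)
  | .box α φ, x => by
    rw [M.val_box]
    have hsub : {t : I | ∃ y, M.progRel α x y ∧ M.val φ y = t} ⊆ Luk n := by
      rintro _ ⟨y, -, rfl⟩
      exact val_mem hn φ y
    rcases Set.eq_empty_or_nonempty {t : I | ∃ y, M.progRel α x y ∧ M.val φ y = t} with h | h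
    · rw [h, sInf_empty]
      exact one_mem_Luk hn
    · exact hsub (h.csInf_mem ((finite_Luk n).subset hsub))

/-- An infimum over a nonempty set of truth values is attained because the chain is finite. The
modal axioms can then be checked at one successor. -/
theorem KripkeModel.val_box_eq (hn : 1 ≤ n) (α : Prog Atm Var) (φ : Form Atm Var) (x : M.World) :
    M.val (.box α φ) x = 1 ∨ ∃ y, M.progRel α x y ∧ M.val φ y = M.val (.box α φ) x := by
  rw [M.val_box]
  rcases Set.eq_empty_or_nonempty {t : I | ∃ y, M.progRel α x y ∧ M.val φ y = t} with h | h
  · left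
    rw [h, sInf_empty]
    rfl
  · refine .inr (h.csInf_mem ((finite_Luk n).subset ?_))
    rintro _ ⟨y, -, rfl⟩
    exact M.val_mem hn φ y

theorem KripkeModel.isValuation (hn : 1 ≤ n) (x : M.World) :
    IsValuation n fun φ : Form Atm Var => M.val φ x where
  mem φ := M.val_mem hn φ x
  zero := by rw [KripkeModel.val]
  neg φ := by rw [KripkeModel.val]
  imp φ ψ := by rw [KripkeModel.val]

/-- The model in which the variables take the values of given formulas. -/
noncomputable def KripkeModel.substModel (hn : 1 ≤ n) (s : Var → Form Atm Var) :
    KripkeModel.{u, v, w} n Atm Var where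
  World := M.World
  nonempty := M.nonempty
  rel := M.rel
  valuation x p := M.val (s p) x
  valuation_mem x p := M.val_mem hn (s p) x

mutual
  -- Stated as an equality of functions, so that it rewrites inside the infimum of a box. Tests
  -- force the simultaneous induction with programs.
  theorem KripkeModel.val_subst (hn : 1 ≤ n) (s : Var → Form Atm Var) :
      ∀ φ : Form Atm Var, M.val (φ.subst s) = (M.substModel hn s).val φ
    | .var p => by rw [Form.subst, KripkeModel.val]; rfl
    | .zero => by rw [Form.subst, KripkeModel.val, KripkeModel.val]; rfl
    | .neg φ => by rw [Form.subst, KripkeModel.val, KripkeModel.val, val_subst hn s φ]; rfl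
    | .imp φ ψ => by
      rw [Form.subst, KripkeModel.val, KripkeModel.val, val_subst hn s φ, val_subst hn s ψ]; rfl
    | .box α φ => by
      rw [Form.subst, KripkeModel.val, KripkeModel.val, val_subst hn s φ, progRel_subst hn s α]; rfl
  theorem KripkeModel.progRel_subst (hn : 1 ≤ n) (s : Var → Form Atm Var) :
      ∀ α : Prog Atm Var, M.progRel (α.subst s) = (M.substModel hn s).progRel α
    | .atom a => by rw [Prog.subst, KripkeModel.progRel, KripkeModel.progRel]; rfl
    | .test φ => by
      rw [Prog.subst, KripkeModel.progRel, KripkeModel.progRel, val_subst hn s φ]; rfl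
    | .seq α β => by
      rw [Prog.subst, KripkeModel.progRel, KripkeModel.progRel, progRel_subst hn s α,
        progRel_subst hn s β]; rfl
    | .union α β => by
      rw [Prog.subst, KripkeModel.progRel, KripkeModel.progRel, progRel_subst hn s α,
        progRel_subst hn s β]; rfl
    | .star α => by
      rw [Prog.subst, KripkeModel.progRel, KripkeModel.progRel, progRel_subst hn s α]; rfl
end

theorem IsValuation.eval_toForm {e : Form Atm Var → I} (he : IsValuation n e) :
    ∀ τ : LukForm Var, e (τ.toForm Atm) = τ.eval fun p => e (.var p)
  | .var p => rfl
  | .zero => he.zero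
  | .neg τ => by rw [LukForm.toForm, he.neg, eval_toForm he τ, LukForm.eval]
  | .imp τ ρ => by
    rw [LukForm.toForm, he.imp, eval_toForm he τ, eval_toForm he ρ, LukForm.eval]

variable {M}

theorem IsAxiom.val_eq_one (hn : 1 ≤ n) {φ : Form Atm Var} (h : IsAxiom n φ) (x : M.World) :
    M.val φ x = 1 := by
  have hv := M.isValuation hn
  have box_le : ∀ {α : Prog Atm Var} {φ : Form Atm Var} {x y : M.World}, M.progRel α x y →
      M.val (.box α φ) x ≤ M.val φ y := fun {α φ x y} hy => M.le_val_box.1 le_rfl y hy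
  have box_le' : ∀ {α : Prog Atm Var} {φ : Form Atm Var} {x y : M.World}, M.progRel α x y →
      (M.val (.box α φ) x : ℝ) ≤ M.val φ y := fun {α φ x y} hy => box_le hy
  cases h with
  | K α p q =>
    refine (hv x).imp_eq_one.2 ?_
    change (_ : ℝ) ≤ _
    rw [(hv x).coe_imp]
    refine le_min ?_ (unitInterval.le_one _)
    rcases M.val_box_eq hn α (.var q) x with h | ⟨y, hy, h⟩
    · rw [h, Set.Icc.coe_one]
      have := (M.val (.box α (.var p)) x).2.2
      have := (M.val (.box α ((Form.var p).imp (.var q))) x).2.2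
      linarith
    · have h1 := box_le' (φ := (Form.var p).imp (.var q)) hy
      have h2 := box_le' (φ := Form.var p) hy
      rw [(hv y).coe_imp] at h1
      have h3 := h1.trans (min_le_left _ _)
      rw [← h]
      linarith
  | box_oplus α p =>
    refine (hv x).iff_eq_one.2 (le_antisymm ?_ (M.le_val_box.2 fun y hy => ?_))
    · change (_ : ℝ) ≤ _
      rw [(hv x).coe_oplus]
      rcases M.val_box_eq hn α (.var p) x with h | ⟨y, hy, h⟩
      · rw [h, Set.Icc.coe_one, min_eq_right (by norm_num)]
        exact unitInterval.le_one _
      · have h1 := box_le' (φ := (Form.var p).oplus (.var p)) hy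
        rwa [(hv y).coe_oplus, h] at h1
    · change (_ : ℝ) ≤ _
      rw [(hv x).coe_oplus, (hv y).coe_oplus]
      have := box_le' (φ := Form.var p) hy
      gcongr
  | box_odot α p =>
    refine (hv x).iff_eq_one.2 (le_antisymm ?_ (M.le_val_box.2 fun y hy => ?_))
    · change (_ : ℝ) ≤ _
      rw [(hv x).coe_odot]
      rcases M.val_box_eq hn α (.var p) x with h | ⟨y, hy, h⟩
      · rw [h, Set.Icc.coe_one, max_eq_left (by norm_num)]
        exact (unitInterval.le_one _).trans (by norm_num)
      · have h1 := box_le' (φ := (Form.var p).odot (.var p)) hy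
        rwa [(hv y).coe_odot, h] at h1
    · change (_ : ℝ) ≤ _
      rw [(hv x).coe_odot, (hv y).coe_odot]
      have := box_le' (φ := Form.var p) hy
      gcongr
  | union α β p =>
    refine (hv x).iff_eq_one.2 ?_
    rw [(hv x).apply_and]
    refine eq_of_forall_le_iff fun t => ?_
    rw [le_min_iff, M.le_val_box, M.le_val_box, M.le_val_box, KripkeModel.progRel]
    exact ⟨fun h => ⟨fun y hy => h y (.inl hy), fun y hy => h y (.inr hy)⟩,
      fun h y hy => hy.elim (h.1 y) (h.2 y)⟩
  | seq α β p =>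
    refine (hv x).iff_eq_one.2 (eq_of_forall_le_iff fun t => ?_)
    rw [M.le_val_box, M.le_val_box, KripkeModel.progRel]
    refine ⟨fun h y hy => M.le_val_box.2 fun z hz => h z ⟨y, hy, hz⟩, ?_⟩
    rintro h z ⟨y, hy, hz⟩
    exact M.le_val_box.1 (h y hy) z hz
  | test p q =>
    refine (hv x).iff_eq_one.2 (eq_of_forall_le_iff fun t => ?_)
    rw [M.le_val_box, KripkeModel.progRel, ← Subtype.coe_le_coe, (hv x).coe_or, (hv x).coe_neg]
    by_cases hq : M.val (.var q) x = 1
    · rw [(hv x).pow_eq_one n hq]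
      constructor
      · exact fun h => le_max_of_le_right (h x ⟨rfl, hq⟩)
      · rintro h y ⟨rfl, -⟩
        have h0 := (M.val (.var p) x).2.1
        simpa [h0] using h
    · rw [(hv x).pow_eq_zero hn hq]
      constructor
      · intro h
        exact le_max_of_le_left (by simpa using t.2.2)
      · rintro h y ⟨rfl, h1⟩
        exact absurd h1 hq
  | star_unfold α p =>
    refine (hv x).iff_eq_one.2 ?_
    rw [(hv x).apply_and]
    refine eq_of_forall_le_iff fun t => ?_
    rw [le_min_iff, M.le_val_box, M.le_val_box, KripkeModel.progRel]
    constructor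
    · refine fun h => ⟨h x .refl, fun y hy => M.le_val_box.2 fun z hz => h z ?_⟩
      rw [KripkeModel.progRel] at hz
      exact .head hy hz
    · rintro ⟨h0, h⟩ y hy
      rcases hy.cases_head with rfl | ⟨z, hz, hy⟩
      · exact h0
      · refine M.le_val_box.1 (h z hz) y ?_
        rwa [KripkeModel.progRel]
  | star_trans α p =>
    refine (hv x).imp_eq_one.2 (M.le_val_box.2 fun y hy => M.le_val_box.2 fun z hz => box_le ?_)
    rw [KripkeModel.progRel] at *
    exact hy.trans hz
  | induction α p =>
    refine (hv x).imp_eq_one.2 ?_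
    rw [(hv x).apply_and]
    -- Either p never decreases along an α-path from x, or p → [α]p is below 1 at some reachable
    -- world, where its n-th power is 0 and kills the premise.
    by_cases h : ∀ y, M.progRel (.star α) x y →
        M.val ((Form.var p).imp (.box α (.var p))) y = 1
    · refine (min_le_left _ _).trans (M.le_val_box.2 fun y hy => ?_)
      rw [KripkeModel.progRel] at hy h
      induction hy with
      | refl => exact le_rfl
      | tail hy hz ih => exact ih.trans (((hv _).imp_eq_one.1 (h _ hy)).trans (box_le hz))
    · push Not at h
      obtain ⟨y, hy, h⟩ := h
      refine (min_le_right _ _).trans ((box_le hy).trans ?_)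
      rw [(hv y).pow_eq_zero hn h]
      exact unitInterval.nonneg'

theorem isDynamicLogic_setOf_isTautology (hn : 1 ≤ n) :
    IsDynamicLogic n {φ : Form Atm Var | IsTautology.{u, v, w} n φ} where
  luk_mem τ hτ M x := by
    rw [(M.isValuation hn x).eval_toForm]
    exact hτ _ fun p => M.val_mem hn _ x
  ax_mem φ h M x := h.val_eq_one hn x
  modus_ponens φ ψ h1 h2 M x := by
    have h := (M.isValuation hn x).imp_eq_one.1 (h2 M x)
    rw [h1 M x] at h
    exact le_antisymm unitInterval.le_one' h
  substitution φ s h M x := by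
    rw [M.val_subst hn s]
    exact h (M.substModel hn s) x
  necessitation φ α h M x :=
    le_antisymm unitInterval.le_one' (M.le_val_box.2 fun y _ => (h M y).ge)

end Soundness

/-! ### Substitution instances of the axioms -/

mutual
  -- The set A plays the role of the variables of φ. Substitution also acts inside tests, so
  -- instantiating an axiom without altering its programs requires variables fresh for them.
  theorem Form.exists_finset_subst_eq [DecidableEq Var] : ∀ φ : Form Atm Var,
      ∃ A : Finset Var, ∀ s : Var → Form Atm Var, (∀ p ∈ A, s p = .var p) → φ.subst s = φ
    | .var p => ⟨{p}, fun s h => by rw [Form.subst, h p (by simp)]⟩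
    | .zero => ⟨∅, fun s _ => by rw [Form.subst]⟩
    | .neg φ => by
      obtain ⟨A, hA⟩ := Form.exists_finset_subst_eq φ
      exact ⟨A, fun s h => by rw [Form.subst, hA s h]⟩
    | .imp φ ψ => by
      obtain ⟨A, hA⟩ := Form.exists_finset_subst_eq φ
      obtain ⟨B, hB⟩ := Form.exists_finset_subst_eq ψ
      exact ⟨A ∪ B, fun s h => by
        rw [Form.subst, hA s fun p hp => h p (Finset.mem_union_left _ hp),
          hB s fun p hp => h p (Finset.mem_union_right _ hp)]⟩
    | .box α φ => by
      obtain ⟨A, hA⟩ := Prog.exists_finset_subst_eq α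
      obtain ⟨B, hB⟩ := Form.exists_finset_subst_eq φ
      exact ⟨A ∪ B, fun s h => by
        rw [Form.subst, hA s fun p hp => h p (Finset.mem_union_left _ hp),
          hB s fun p hp => h p (Finset.mem_union_right _ hp)]⟩
  theorem Prog.exists_finset_subst_eq [DecidableEq Var] : ∀ α : Prog Atm Var,
      ∃ A : Finset Var, ∀ s : Var → Form Atm Var, (∀ p ∈ A, s p = .var p) → α.subst s = α
    | .atom a => ⟨∅, fun s _ => by rw [Prog.subst]⟩
    | .test φ => by
      obtain ⟨A, hA⟩ := Form.exists_finset_subst_eq φ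
      exact ⟨A, fun s h => by rw [Prog.subst, hA s h]⟩
    | .seq α β => by
      obtain ⟨A, hA⟩ := Prog.exists_finset_subst_eq α
      obtain ⟨B, hB⟩ := Prog.exists_finset_subst_eq β
      exact ⟨A ∪ B, fun s h => by
        rw [Prog.subst, hA s fun p hp => h p (Finset.mem_union_left _ hp),
          hB s fun p hp => h p (Finset.mem_union_right _ hp)]⟩
    | .union α β => by
      obtain ⟨A, hA⟩ := Prog.exists_finset_subst_eq α
      obtain ⟨B, hB⟩ := Prog.exists_finset_subst_eq β
      exact ⟨A ∪ B, fun s h => by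
        rw [Prog.subst, hA s fun p hp => h p (Finset.mem_union_left _ hp),
          hB s fun p hp => h p (Finset.mem_union_right _ hp)]⟩
    | .star α => by
      obtain ⟨A, hA⟩ := Prog.exists_finset_subst_eq α
      exact ⟨A, fun s h => by rw [Prog.subst, hA s h]⟩
end

/-- Two programs are fixed by some substitution of two given formulas for two variables. -/
theorem exists_subst_fixing [Infinite Var] (α β : Prog Atm Var) (φ ψ : Form Atm Var) :
    ∃ (p q : Var) (s : Var → Form Atm Var),
      s p = φ ∧ s q = ψ ∧ α.subst s = α ∧ β.subst s = β := by
  classical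
  obtain ⟨A, hA⟩ := α.exists_finset_subst_eq
  obtain ⟨B, hB⟩ := β.exists_finset_subst_eq
  obtain ⟨p, hp⟩ := Infinite.exists_notMem_finset (A ∪ B)
  obtain ⟨q, hq⟩ := Infinite.exists_notMem_finset (insert p (A ∪ B))
  rw [Finset.mem_insert, not_or] at hq
  refine ⟨p, q, fun r => if r = p then φ else if r = q then ψ else .var r, by simp,
    by simp [hq.1], hA _ fun r hr => ?_, hB _ fun r hr => ?_⟩ <;>
  · have h1 : r ≠ p := by
      rintro rfl
      exact hp (by simp [hr])
    have h2 : r ≠ q := by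
      rintro rfl
      exact hq.2 (by simp [hr])
    simp [h1, h2]

theorem Form.subst_pow (s : Var → Form Atm Var) (φ : Form Atm Var) :
    ∀ k, (φ.pow k).subst s = (φ.subst s).pow k
  | 0 => by simp only [Form.pow, Form.one, Form.subst]
  | 1 => by simp only [Form.pow]
  | k + 2 => by
    rw [Form.pow, Form.pow, ← Form.subst_pow s φ (k + 1)]
    simp only [Form.odot, Form.oplus, Form.subst]

theorem PDL_isDynamicLogic : IsDynamicLogic n (PDL n Atm Var) := (PDL_isLeast n Atm Var).1

section Instances

variable [Infinite Var] (α β : Prog Atm Var) (φ ψ : Form Atm Var)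

theorem K_mem_PDL :
    (Form.box α (φ.imp ψ)).imp ((Form.box α φ).imp (.box α ψ)) ∈ PDL n Atm Var := by
  obtain ⟨p, q, s, hp, hq, hα, -⟩ := exists_subst_fixing α α φ ψ
  simpa only [Form.subst, hp, hq, hα] using
    PDL_isDynamicLogic.substitution _ s (PDL_isDynamicLogic.ax_mem _ (IsAxiom.K (n := n) α p q))

theorem box_oplus_mem_PDL :
    (Form.box α (φ.oplus φ)).iff ((Form.box α φ).oplus (.box α φ)) ∈ PDL n Atm Var := by
  obtain ⟨p, q, s, hp, hq, hα, -⟩ := exists_subst_fixing α α φ φ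
  simpa only [Form.iff, Form.oplus, Form.odot, Form.subst, hp, hα] using
    PDL_isDynamicLogic.substitution _ s
      (PDL_isDynamicLogic.ax_mem _ (IsAxiom.box_oplus (n := n) α p))

theorem box_odot_mem_PDL :
    (Form.box α (φ.odot φ)).iff ((Form.box α φ).odot (.box α φ)) ∈ PDL n Atm Var := by
  obtain ⟨p, q, s, hp, hq, hα, -⟩ := exists_subst_fixing α α φ φ
  simpa only [Form.iff, Form.oplus, Form.odot, Form.subst, hp, hα] using
    PDL_isDynamicLogic.substitution _ s
      (PDL_isDynamicLogic.ax_mem _ (IsAxiom.box_odot (n := n) α p))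

theorem union_mem_PDL :
    (Form.box (.union α β) φ).iff ((Form.box α φ).and (.box β φ)) ∈ PDL n Atm Var := by
  obtain ⟨p, q, s, hp, hq, hα, hβ⟩ := exists_subst_fixing α β φ φ
  simpa only [Form.iff, Form.oplus, Form.odot, Form.and, Form.or, Form.subst, Prog.subst, hp, hα,
    hβ] using
    PDL_isDynamicLogic.substitution _ s
      (PDL_isDynamicLogic.ax_mem _ (IsAxiom.union (n := n) α β p))

theorem seq_mem_PDL :
    (Form.box (.seq α β) φ).iff (Form.box α (.box β φ)) ∈ PDL n Atm Var := by
  obtain ⟨p, q, s, hp, hq, hα, hβ⟩ := exists_subst_fixing α β φ φ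
  simpa only [Form.iff, Form.oplus, Form.odot, Form.subst, Prog.subst, hp, hα, hβ] using
    PDL_isDynamicLogic.substitution _ s
      (PDL_isDynamicLogic.ax_mem _ (IsAxiom.seq (n := n) α β p))

theorem test_mem_PDL :
    (Form.box (.test ψ) φ).iff (Form.or (.neg (ψ.pow n)) φ) ∈ PDL n Atm Var := by
  classical
  obtain ⟨p, q, hpq⟩ := exists_pair_ne Var
  -- No arbitrary program occurs in this axiom, so freshness does not matter.
  have h := PDL_isDynamicLogic.substitution _ (fun r => if r = p then φ else ψ)
    (PDL_isDynamicLogic.ax_mem _ (IsAxiom.test (n := n) (Atm := Atm) p q))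
  simpa only [Form.iff, Form.oplus, Form.odot, Form.or, Form.subst, Prog.subst, Form.subst_pow,
    if_pos, if_neg hpq.symm] using h

theorem star_unfold_mem_PDL :
    (Form.box (.star α) φ).iff (φ.and (.box α (.box (.star α) φ))) ∈ PDL n Atm Var := by
  obtain ⟨p, q, s, hp, hq, hα, -⟩ := exists_subst_fixing α α φ φ
  simpa only [Form.iff, Form.oplus, Form.odot, Form.and, Form.or, Form.subst, Prog.subst, hp, hα]
    using PDL_isDynamicLogic.substitution _ s
      (PDL_isDynamicLogic.ax_mem _ (IsAxiom.star_unfold (n := n) α p))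

theorem induction_mem_PDL :
    (φ.and (.box (.star α) ((φ.imp (.box α φ)).pow n))).imp (.box (.star α) φ) ∈
      PDL n Atm Var := by
  obtain ⟨p, q, s, hp, hq, hα, -⟩ := exists_subst_fixing α α φ φ
  simpa only [Form.and, Form.or, Form.subst, Prog.subst, Form.subst_pow, hp, hα]
    using PDL_isDynamicLogic.substitution _ s
      (PDL_isDynamicLogic.ax_mem _ (IsAxiom.induction (n := n) α p))

end Instances

/-! ### Existence of valuations -/

/-- The extension of an arbitrary assignment of values to variables and boxed formulas. -/
noncomputable def Form.extend (e : Form Atm Var → Luk n) : Form Atm Var → I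
  | .var p => e (.var p)
  | .zero => 0
  | .neg φ => lukNeg (φ.extend e)
  | .imp φ ψ => lukImp (φ.extend e) (ψ.extend e)
  | .box α φ => e (.box α φ)

theorem Form.extend_mem (hn : 1 ≤ n) (e : Form Atm Var → Luk n) :
    ∀ φ : Form Atm Var, φ.extend e ∈ Luk n
  | .var p => (e (.var p)).2
  | .zero => zero_mem_Luk n
  | .neg φ => lukNeg_mem_Luk hn (φ.extend_mem hn e)
  | .imp φ ψ => lukImp_mem_Luk hn (φ.extend_mem hn e) (ψ.extend_mem hn e)
  | .box α φ => (e (.box α φ)).2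

theorem isValuation_extend (hn : 1 ≤ n) (e : Form Atm Var → Luk n) :
    IsValuation n fun φ : Form Atm Var => φ.extend e where
  mem := Form.extend_mem hn e
  zero := rfl
  neg _ := rfl
  imp _ _ := rfl

theorem continuous_lukNeg : Continuous lukNeg :=
  Continuous.subtype_mk (by fun_prop) _

theorem continuous_lukImp : Continuous fun x : I × I => lukImp x.1 x.2 :=
  Continuous.subtype_mk (by fun_prop) _

/-- Continuity for the product topology on assignments, which is compact because the chain is
finite. It serves the compactness argument below. -/
theorem Form.continuous_extend :
    ∀ φ : Form Atm Var, Continuous fun e : Form Atm Var → Luk n => φ.extend e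
  | .var _ => continuous_subtype_val.comp (continuous_apply _)
  | .zero => continuous_const
  | .neg φ => continuous_lukNeg.comp φ.continuous_extend
  | .imp φ ψ => continuous_lukImp.comp (φ.continuous_extend.prodMk ψ.continuous_extend)
  | .box _ _ => continuous_subtype_val.comp (continuous_apply _)

/-- Replace variables and boxed formulas by variables. -/
def Form.skeleton (g : Form Atm Var → Var) : Form Atm Var → LukForm Var
  | .var p => .var (g (.var p))
  | .zero => .zero
  | .neg φ => .neg (φ.skeleton g)
  | .imp φ ψ => .imp (φ.skeleton g) (ψ.skeleton g)
  | .box α φ => .var (g (.box α φ))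

theorem Form.eval_skeleton (g : Form Atm Var → Var) (e : Var → Luk n) :
    ∀ φ : Form Atm Var, (φ.skeleton g).eval (fun p => (e p : I)) = φ.extend (fun ψ => e (g ψ))
  | .var p => rfl
  | .zero => rfl
  | .neg φ => by rw [Form.skeleton, LukForm.eval, Form.eval_skeleton g e φ, Form.extend]
  | .imp φ ψ => by
    rw [Form.skeleton, LukForm.eval, Form.eval_skeleton g e φ, Form.eval_skeleton g e ψ,
      Form.extend]
  | .box α φ => rfl

theorem Form.exists_finset_skeleton_subst [DecidableEq (Form Atm Var)] :
    ∀ φ : Form Atm Var, ∃ A : Finset (Form Atm Var), ∀ (g : Form Atm Var → Var)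
      (s : Var → Form Atm Var), (∀ ψ ∈ A, s (g ψ) = ψ) →
        ((φ.skeleton g).toForm Atm).subst s = φ
  | .var p => ⟨{.var p}, fun g s h => by
      rw [Form.skeleton, LukForm.toForm, Form.subst, h _ (by simp)]⟩
  | .zero => ⟨∅, fun g s _ => by rw [Form.skeleton, LukForm.toForm, Form.subst]⟩
  | .neg φ => by
    obtain ⟨A, hA⟩ := Form.exists_finset_skeleton_subst φ
    exact ⟨A, fun g s h => by rw [Form.skeleton, LukForm.toForm, Form.subst, hA g s h]⟩
  | .imp φ ψ => by
    obtain ⟨A, hA⟩ := Form.exists_finset_skeleton_subst φ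
    obtain ⟨B, hB⟩ := Form.exists_finset_skeleton_subst ψ
    exact ⟨A ∪ B, fun g s h => by
      rw [Form.skeleton, LukForm.toForm, Form.subst,
        hA g s fun p hp => h p (Finset.mem_union_left _ hp),
        hB g s fun p hp => h p (Finset.mem_union_right _ hp)]⟩
  | .box α φ => ⟨{.box α φ}, fun g s h => by
      rw [Form.skeleton, LukForm.toForm, Form.subst, h _ (by simp)]⟩

/-- Formulas with value `1` under all valuations are provable. -/
theorem mem_PDL_of_forall_isValuation [Infinite Var] (hn : 1 ≤ n) {φ : Form Atm Var}
    (h : ∀ e : Form Atm Var → I, IsValuation n e → e φ = 1) : φ ∈ PDL n Atm Var := by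
  classical
  obtain ⟨A, hA⟩ := φ.exists_finset_skeleton_subst
  -- Only the finitely many variables and boxed formulas in A need distinct names; there may be more
  -- formulas than variables.
  obtain ⟨g, hg⟩ : ∃ g : Form Atm Var → Var, Set.InjOn g A := by
    let f : A ↪ Var := (Finite.equivFin A).toEmbedding.trans
      (Fin.valEmbedding.trans (Infinite.natEmbedding Var))
    refine ⟨fun ψ => if h : ψ ∈ A then f ⟨ψ, h⟩ else Infinite.natEmbedding Var 0, ?_⟩
    intro ψ hψ χ hχ hψχ
    rw [Finset.mem_coe] at hψ hχ
    simpa [hψ, hχ] using hψχ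
  have : Nonempty (Form Atm Var) := ⟨.zero⟩
  rw [← hA g (Function.invFunOn g A) fun ψ hψ => hg.leftInvOn_invFunOn hψ]
  refine PDL_isDynamicLogic.substitution _ _ (PDL_isDynamicLogic.luk_mem _ fun e he => ?_)
  rw [Form.eval_skeleton g fun p => ⟨e p, he p⟩]
  exact h _ (isValuation_extend hn _)

/-- A set of formulas that contains the Łukasiewicz tautologies and is closed under modus ponens
is the intersection of the valuations above it. -/
theorem exists_isValuation_of_notMem (hn : 1 ≤ n) {T : Set (Form Atm Var)}
    (hT : ∀ φ, (∀ e : Form Atm Var → I, IsValuation n e → e φ = 1) → φ ∈ T)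
    (hmp : ∀ φ ψ, φ ∈ T → φ.imp ψ ∈ T → ψ ∈ T) {χ : Form Atm Var} (hχ : χ ∉ T) :
    ∃ e : Form Atm Var → I, IsValuation n e ∧ (∀ ψ ∈ T, e ψ = 1) ∧ e χ ≠ 1 := by
  have : Finite (Luk n) := (finite_Luk n).to_subtype
  have hn0 : (0 : ℝ) < n := by positivity
  -- The gap below 1 turns "χ is not 1" into a closed condition.
  have hs : IsCompact {e : Form Atm Var → Luk n | (χ.extend e : ℝ) ≤ 1 - 1 / n} :=
    (isClosed_le (continuous_subtype_val.comp χ.continuous_extend) continuous_const).isCompact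
  obtain ⟨e, he, heT⟩ := hs.inter_iInter_nonempty
    (fun ψ : T => {e : Form Atm Var → Luk n | ψ.1.extend e = 1})
    (fun ψ => isClosed_eq ψ.1.continuous_extend continuous_const) (fun F => by
      by_contra hF
      refine hχ ?_
      -- Deduction theorem for finitely many premises from T: each is moved into the formula as an
      -- n-fold antecedent, then discharged by n uses of modus ponens.
      have key : ∀ (l : List T) (ρ : Form Atm Var), (∀ e : Form Atm Var → I, IsValuation n e →
          (∀ ψ ∈ l, e ψ.1 = 1) → e ρ = 1) → ρ ∈ T := by
        intro l
        induction l with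
        | nil => exact fun ρ h => hT ρ fun e he => h e he (by simp)
        | cons ψ l ih =>
          intro ρ h
          have hmem : (Form.imp ψ.1)^[n] ρ ∈ T := by
            refine ih _ fun e he hl => he.imp_iterate_eq_one hn fun hψ => h e he ?_
            simpa [hψ] using hl
          have hiter : ∀ k, (Form.imp ψ.1)^[k] ρ ∈ T → ρ ∈ T := by
            intro k
            induction k with
            | zero => exact id
            | succ k ihk =>
              rw [Function.iterate_succ_apply']
              exact fun h => ihk (hmp _ _ ψ.2 h)
          exact hiter n hmem
      refine key F.toList χ fun e he hF' => ?_
      by_contra h1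
      refine hF ⟨fun ψ => ⟨e ψ, he.mem ψ⟩, ?_, ?_⟩
      all_goals
        -- A valuation is determined by its values on variables and boxed formulas.
        have hext : ∀ ψ : Form Atm Var, ψ.extend (fun ψ => (⟨e ψ, he.mem ψ⟩ : Luk n)) = e ψ := by
          intro ψ
          induction ψ using Form.rec (motive_2 := fun _ => True) with
          | var p => rfl
          | zero => exact he.zero.symm
          | neg φ ih => rw [Form.extend, ih, he.neg]
          | imp φ ψ ih1 ih2 => rw [Form.extend, ih1, ih2, he.imp]
          | box α φ => rfl
          | _ => trivial
      · change (χ.extend _ : ℝ) ≤ _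
        rw [hext]
        exact le_of_lt_one_of_mem_Luk hn (he.mem χ) h1
      · refine Set.mem_iInter₂.2 fun ψ hψ => ?_
        change ψ.1.extend _ = 1
        rw [hext]
        exact hF' ψ (by simpa using hψ))
  refine ⟨fun φ => φ.extend e, isValuation_extend hn e,
    fun ψ hψ => Set.mem_iInter.1 heT ⟨ψ, hψ⟩, fun h => ?_⟩
  change (χ.extend e : ℝ) ≤ _ at he
  change χ.extend e = 1 at h
  rw [h, Set.Icc.coe_one] at he
  have : 0 < 1 / (n : ℝ) := by positivity
  linarith

/-! ### The canonical worlds -/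

/-- The worlds of the canonical model: valuations under which all theorems have value `1`. -/
structure CanonicalWorld (n : ℕ) (Atm : Type u) (Var : Type v) where
  /-- The values of the formulas. -/
  val : Form Atm Var → I
  isValuation : IsValuation n val
  eq_one : ∀ φ ∈ PDL n Atm Var, val φ = 1

/-- The canonical relation of a program. -/
def CanonicalWorld.Rel (α : Prog Atm Var) (x y : CanonicalWorld n Atm Var) : Prop :=
  ∀ φ, x.val (.box α φ) ≤ y.val φ

theorem mem_PDL_iff [Infinite Var] (hn : 1 ≤ n) {φ : Form Atm Var} :
    φ ∈ PDL n Atm Var ↔ ∀ x : CanonicalWorld n Atm Var, x.val φ = 1 := by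
  refine ⟨fun h x => x.eq_one φ h, fun h => ?_⟩
  by_contra hφ
  obtain ⟨e, he, h1, h2⟩ := exists_isValuation_of_notMem hn
    (fun ψ hψ => mem_PDL_of_forall_isValuation hn hψ) PDL_isDynamicLogic.modus_ponens hφ
  exact h2 (h ⟨e, he, h1⟩)

namespace CanonicalWorld

variable [Infinite Var]

theorem val_threshold_box {x : CanonicalWorld n Atm Var}
    {τ : Form Atm Var → Form Atm Var}
    (hτ : ∀ (e : Form Atm Var → I) (f : Form Atm Var → Form Atm Var), IsValuation n e →
        (∀ ψ, e (f (ψ.oplus ψ)) = e ((f ψ).oplus (f ψ))) →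
        (∀ ψ, e (f (ψ.odot ψ)) = e ((f ψ).odot (f ψ))) →
        ∀ ψ, e (f (τ ψ)) = e (τ (f ψ))) (α : Prog Atm Var) (ψ : Form Atm Var) :
    x.val (.box α (τ ψ)) = x.val (τ (.box α ψ)) :=
  hτ x.val (Form.box α) x.isValuation
    (fun ψ => x.isValuation.iff_eq_one.1 (x.eq_one _ (box_oplus_mem_PDL α ψ)))
    (fun ψ => x.isValuation.iff_eq_one.1 (x.eq_one _ (box_odot_mem_PDL α ψ))) ψ

/-- If [α]φ has value t > 0 at x and τ is the threshold at t, then [α]τφ has the value of τ[α]φ,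
namely 1. So τφ is 1 at y, that is, φ is at least t there. -/
theorem rel_iff (hn : 1 ≤ n) {α : Prog Atm Var} {x y : CanonicalWorld n Atm Var} :
    Rel α x y ↔ ∀ φ, x.val (.box α φ) = 1 → y.val φ = 1 := by
  refine ⟨fun h φ hφ => le_antisymm unitInterval.le_one' (hφ ▸ h φ), fun h φ => ?_⟩
  by_cases h0 : x.val (.box α φ) = 0
  · rw [h0]
    exact unitInterval.nonneg'
  obtain ⟨τ, hτ, hτb⟩ := exists_threshold_operator (Atm := Atm) (Var := Var) hn
    (x.isValuation.mem (.box α φ)) h0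
  by_contra hlt
  have h1 := h (τ φ) (by rw [val_threshold_box hτb]; exact (hτ _ x.isValuation _).1 le_rfl)
  rw [(hτ _ y.isValuation _).2 (not_le.1 hlt)] at h1
  exact zero_ne_one h1

/-- The formulas whose α-box is 1 at x contain the theorems by necessitation and are closed under
modus ponens by K. Some valuation above them separates φ. -/
theorem exists_rel_ne_one (hn : 1 ≤ n) {α : Prog Atm Var} {x : CanonicalWorld n Atm Var}
    {φ : Form Atm Var} (h : x.val (.box α φ) ≠ 1) : ∃ y, Rel α x y ∧ y.val φ ≠ 1 := by
  have hPDL : ∀ ψ ∈ PDL n Atm Var, x.val (.box α ψ) = 1 := fun ψ hψ =>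
    x.eq_one _ (PDL_isDynamicLogic.necessitation _ α hψ)
  obtain ⟨e, he, h1, h2⟩ := exists_isValuation_of_notMem hn
    (T := {ψ | x.val (.box α ψ) = 1}) (χ := φ)
    (fun ψ hψ => hPDL ψ (mem_PDL_of_forall_isValuation hn hψ)) (fun ψ χ hψ hψχ => by
      have hK := x.isValuation.imp_eq_one.1 (x.eq_one _ (K_mem_PDL α ψ χ))
      rw [Set.mem_ofPred_eq] at hψ hψχ ⊢
      rw [hψχ] at hK
      have := x.isValuation.imp_eq_one.1 (le_antisymm unitInterval.le_one' hK)
      rw [hψ] at this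
      exact le_antisymm unitInterval.le_one' this) h
  exact ⟨⟨e, he, fun ψ hψ => h1 ψ (hPDL ψ hψ)⟩, (rel_iff hn).2 h1, h2⟩

theorem val_box_eq_one (hn : 1 ≤ n) {α : Prog Atm Var} {x : CanonicalWorld n Atm Var}
    {φ : Form Atm Var} (h : ∀ y, Rel α x y → y.val φ = 1) : x.val (.box α φ) = 1 := by
  by_contra h1
  obtain ⟨y, hy, hφ⟩ := exists_rel_ne_one hn h1
  exact hφ (h y hy)

/-- The two-valued existence lemma, applied to φ under the threshold at t. -/
theorem exists_rel_le (hn : 1 ≤ n) {α : Prog Atm Var} {x : CanonicalWorld n Atm Var}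
    {φ : Form Atm Var} {t : I} (ht : t ∈ Luk n) (h : x.val (.box α φ) < t) :
    ∃ y, Rel α x y ∧ y.val φ < t := by
  obtain ⟨τ, hτ, hτb⟩ := exists_threshold_operator (Atm := Atm) (Var := Var) hn ht
    (unitInterval.nonneg'.trans_lt h).ne'
  have h0 := (hτ _ x.isValuation _).2 h
  rw [← val_threshold_box hτb] at h0
  obtain ⟨y, hy, hne⟩ := exists_rel_ne_one hn (h0.trans_ne zero_ne_one)
  exact ⟨y, hy, not_le.1 fun hle => hne ((hτ _ y.isValuation _).1 hle)⟩

theorem val_union (x : CanonicalWorld n Atm Var) (α β : Prog Atm Var) (φ : Form Atm Var) :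
    x.val (.box (.union α β) φ) = min (x.val (.box α φ)) (x.val (.box β φ)) := by
  rw [x.isValuation.iff_eq_one.1 (x.eq_one _ (union_mem_PDL α β φ)), x.isValuation.apply_and]

theorem val_seq (x : CanonicalWorld n Atm Var) (α β : Prog Atm Var) (φ : Form Atm Var) :
    x.val (.box (.seq α β) φ) = x.val (.box α (.box β φ)) :=
  x.isValuation.iff_eq_one.1 (x.eq_one _ (seq_mem_PDL α β φ))

theorem val_star (x : CanonicalWorld n Atm Var) (α : Prog Atm Var) (φ : Form Atm Var) :
    x.val (.box (.star α) φ) = min (x.val φ) (x.val (.box α (.box (.star α) φ))) := by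
  rw [x.isValuation.iff_eq_one.1 (x.eq_one _ (star_unfold_mem_PDL α φ)), x.isValuation.apply_and]

theorem val_test_of_eq_one (x : CanonicalWorld n Atm Var) {ψ : Form Atm Var}
    (h : x.val ψ = 1) (φ : Form Atm Var) : x.val (.box (.test ψ) φ) = x.val φ := by
  rw [x.isValuation.iff_eq_one.1 (x.eq_one _ (test_mem_PDL φ ψ)), ← Subtype.coe_inj,
    x.isValuation.coe_or, x.isValuation.coe_neg, x.isValuation.pow_eq_one n h]
  simpa using unitInterval.nonneg _

theorem val_test_of_ne_one (hn : 1 ≤ n) (x : CanonicalWorld n Atm Var) {ψ : Form Atm Var}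
    (h : x.val ψ ≠ 1) (φ : Form Atm Var) : x.val (.box (.test ψ) φ) = 1 := by
  rw [x.isValuation.iff_eq_one.1 (x.eq_one _ (test_mem_PDL φ ψ)), ← Subtype.coe_inj,
    x.isValuation.coe_or, x.isValuation.coe_neg, x.isValuation.pow_eq_zero hn h]
  simpa using unitInterval.le_one _

/-- If `φ` is invariant under `α` then it is invariant under `α*`. -/
theorem val_star_eq_one (hn : 1 ≤ n) {α : Prog Atm Var} {φ : Form Atm Var}
    (h : ∀ x : CanonicalWorld n Atm Var, x.val φ ≤ x.val (.box α φ))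
    (x : CanonicalWorld n Atm Var) (hx : x.val φ = 1) : x.val (.box (.star α) φ) = 1 := by
  -- Invariance at every canonical world makes this power a theorem, so it can be necessitated under
  -- α*.
  have h1 : (φ.imp (.box α φ)).pow n ∈ PDL n Atm Var := (mem_PDL_iff hn).2 fun y =>
    y.isValuation.pow_eq_one n (y.isValuation.imp_eq_one.2 (h y))
  have h2 := x.isValuation.imp_eq_one.1 (x.eq_one _ (induction_mem_PDL α φ))
  rw [x.isValuation.apply_and, hx,
    x.eq_one _ (PDL_isDynamicLogic.necessitation _ (.star α) h1), min_self] at h2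
  exact le_antisymm unitInterval.le_one' h2

end CanonicalWorld

/-! ### Definable sets of canonical worlds -/

/-- A set of canonical worlds whose characteristic function is given by a formula. -/
def IsDefinable (D : Set (CanonicalWorld n Atm Var)) : Prop :=
  ∃ χ : Form Atm Var, ∀ x : CanonicalWorld n Atm Var,
    (x ∈ D → x.val χ = 1) ∧ (x ∉ D → x.val χ = 0)

namespace IsDefinable

variable {D E : Set (CanonicalWorld n Atm Var)}

theorem univ : IsDefinable (Set.univ : Set (CanonicalWorld n Atm Var)) :=
  ⟨.one, fun x => ⟨fun _ => x.isValuation.apply_one, fun h => absurd trivial h⟩⟩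

theorem compl (hD : IsDefinable D) : IsDefinable Dᶜ := by
  obtain ⟨χ, h⟩ := hD
  refine ⟨χ.neg, fun x => ⟨fun hx => ?_, fun hx => ?_⟩⟩
  · rw [← Subtype.coe_inj, x.isValuation.coe_neg, (h x).2 hx]
    simp
  · rw [← Subtype.coe_inj, x.isValuation.coe_neg, (h x).1 (not_not.1 hx)]
    simp

theorem inter (hD : IsDefinable D) (hE : IsDefinable E) : IsDefinable (D ∩ E) := by
  obtain ⟨χ, h⟩ := hD
  obtain ⟨ρ, h'⟩ := hE
  refine ⟨χ.and ρ, fun x => ⟨fun hx => ?_, fun hx => ?_⟩⟩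
  · rw [x.isValuation.apply_and, (h x).1 hx.1, (h' x).1 hx.2, min_self]
  · rw [x.isValuation.apply_and]
    by_cases hxD : x ∈ D
    · rw [(h' x).2 fun hxE => hx ⟨hxD, hxE⟩]
      exact min_eq_right unitInterval.nonneg'
    · rw [(h x).2 hxD]
      exact min_eq_left unitInterval.nonneg'

theorem biInter {ι : Type*} {s : Set ι} (hs : s.Finite)
    {D : ι → Set (CanonicalWorld n Atm Var)} (hD : ∀ i ∈ s, IsDefinable (D i)) :
    IsDefinable (⋂ i ∈ s, D i) := by
  induction s, hs using Set.Finite.induction_on with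
  | empty => simpa using univ
  | insert _ _ ih =>
    rw [Set.biInter_insert]
    exact (hD _ (Set.mem_insert _ _)).inter (ih fun i hi => hD i (Set.mem_insert_of_mem _ hi))

theorem setOf_le (hn : 1 ≤ n) (φ : Form Atm Var) {t : I} (ht : t ∈ Luk n) :
    IsDefinable {x : CanonicalWorld n Atm Var | t ≤ x.val φ} := by
  by_cases h0 : t = 0
  · subst h0
    simpa only [unitInterval.nonneg', Set.ofPred_true] using univ
  obtain ⟨τ, hτ, -⟩ := exists_threshold_operator (Atm := Atm) (Var := Var) hn ht h0
  exact ⟨τ φ, fun x => ⟨(hτ _ x.isValuation φ).1, fun h =>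
    (hτ _ x.isValuation φ).2 (not_le.1 h)⟩⟩

theorem setOf_eq (hn : 1 ≤ n) (φ : Form Atm Var) {t : I} (ht : t ∈ Luk n) :
    IsDefinable {x : CanonicalWorld n Atm Var | x.val φ = t} := by
  -- The upper bound on φ is a lower bound on its negation.
  have h := (setOf_le hn φ.neg (lukNeg_mem_Luk hn ht)).inter (setOf_le hn φ ht)
  convert h using 1
  ext x
  rw [Set.mem_inter_iff, Set.mem_ofPred_eq, Set.mem_ofPred_eq, Set.mem_ofPred_eq, x.isValuation.neg,
    le_antisymm_iff]
  refine and_congr_left' ?_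
  rw [← Subtype.coe_le_coe, ← Subtype.coe_le_coe, coe_lukNeg, coe_lukNeg, sub_le_sub_iff_left]

end IsDefinable

/-- If ψ is not 1 at x then [ψ?]0 is 1 there, so no successor exists. Otherwise y dominates x on
every formula, and on its negation too, which forces equality. -/
theorem CanonicalWorld.rel_test [Infinite Var] (hn : 1 ≤ n) {ψ : Form Atm Var}
    {x y : CanonicalWorld n Atm Var} (h : Rel (.test ψ) x y) : x.val ψ = 1 ∧ x.val = y.val := by
  have h1 : x.val ψ = 1 := by
    by_contra h1
    have h0 := h .zero
    rw [x.val_test_of_ne_one hn h1, y.isValuation.zero] at h0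
    exact absurd h0 (not_le.2 zero_lt_one)
  have hle : ∀ φ, x.val φ ≤ y.val φ := fun φ => x.val_test_of_eq_one h1 φ ▸ h φ
  refine ⟨h1, funext fun φ => le_antisymm (hle φ) ?_⟩
  have := hle φ.neg
  rw [← Subtype.coe_le_coe, x.isValuation.coe_neg, y.isValuation.coe_neg] at this
  exact Subtype.coe_le_coe.1 (by linarith)

/-! ### The Fischer–Ladner closure -/

/-- The formulas on which the filtration at a formula immediately depends. -/
def Form.needs : Form Atm Var → Set (Form Atm Var)
  | .var _ => ∅
  | .zero => ∅
  | .neg φ => {φ}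
  | .imp φ ψ => {φ, ψ}
  | .box (.atom _) φ => {φ}
  | .box (.test ψ) φ => {φ, ψ}
  | .box (.seq α β) φ => {φ, .box α (.box β φ)}
  | .box (.union α β) φ => {φ, .box α φ, .box β φ}
  | .box (.star α) φ => {φ, .box α (.box (.star α) φ)}

mutual
  /-- The Fischer–Ladner closure of a formula. -/
  def Form.closure : Form Atm Var → Set (Form Atm Var)
    | .var p => {.var p}
    | .zero => {.zero}
    | .neg φ => insert (.neg φ) φ.closure
    | .imp φ ψ => insert (.imp φ ψ) (φ.closure ∪ ψ.closure)
    | .box α φ => α.closure φ ∪ φ.closure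
  /-- The part of the Fischer–Ladner closure of `[α]φ` that comes from `α`. -/
  def Prog.closure : Prog Atm Var → Form Atm Var → Set (Form Atm Var)
    | .atom a, φ => {.box (.atom a) φ}
    | .test ψ, φ => insert (.box (.test ψ) φ) ψ.closure
    | .seq α β, φ => insert (.box (.seq α β) φ) (α.closure (.box β φ) ∪ β.closure φ)
    | .union α β, φ => insert (.box (.union α β) φ) (α.closure φ ∪ β.closure φ)
    | .star α, φ => insert (.box (.star α) φ) (α.closure (.box (.star α) φ))
end

theorem Prog.box_mem_closure (α : Prog Atm Var) (φ : Form Atm Var) : .box α φ ∈ α.closure φ := by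
  cases α <;> simp [Prog.closure]

theorem Form.mem_closure (φ : Form Atm Var) : φ ∈ φ.closure := by
  cases φ <;> simp [Form.closure, Prog.box_mem_closure]

mutual
  -- The recursion descends through the program and carries the formula as a parameter: unfolding α*
  -- lengthens the formula but passes to the smaller program α.
  theorem Form.finite_closure : ∀ φ : Form Atm Var, φ.closure.Finite
    | .var p => by rw [Form.closure]; exact Set.finite_singleton _
    | .zero => by rw [Form.closure]; exact Set.finite_singleton _
    | .neg φ => by rw [Form.closure]; exact φ.finite_closure.insert _
    | .imp φ ψ => by
      rw [Form.closure]; exact (φ.finite_closure.union ψ.finite_closure).insert _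
    | .box α φ => by rw [Form.closure]; exact (α.finite_closure φ).union φ.finite_closure
  theorem Prog.finite_closure : ∀ (α : Prog Atm Var) (φ : Form Atm Var), (α.closure φ).Finite
    | .atom a, φ => by rw [Prog.closure]; exact Set.finite_singleton _
    | .test ψ, φ => by rw [Prog.closure]; exact ψ.finite_closure.insert _
    | .seq α β, φ => by
      rw [Prog.closure]; exact ((α.finite_closure _).union (β.finite_closure _)).insert _
    | .union α β, φ => by
      rw [Prog.closure]; exact ((α.finite_closure _).union (β.finite_closure _)).insert _
    | .star α, φ => by rw [Prog.closure]; exact (α.finite_closure _).insert _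
end

mutual
  theorem Form.needs_subset_closure :
      ∀ φ : Form Atm Var, ∀ χ ∈ φ.closure, χ.needs ⊆ φ.closure
    | .var p => by simp [Form.closure, Form.needs]
    | .zero => by simp [Form.closure, Form.needs]
    | .neg φ => by
      have h := φ.needs_subset_closure
      have hm := φ.mem_closure
      simp only [Form.closure, Set.mem_insert_iff]
      rintro χ (rfl | hχ)
      · simp [Form.needs, hm]
      · exact (h χ hχ).trans (Set.subset_insert _ _)
    | .imp φ ψ => by
      have h1 := φ.needs_subset_closure
      have h2 := ψ.needs_subset_closure
      have hm1 := φ.mem_closure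
      have hm2 := ψ.mem_closure
      simp only [Form.closure, Set.mem_insert_iff, Set.mem_union]
      rintro χ (rfl | hχ | hχ)
      · simp [Form.needs, Set.insert_subset_iff, hm1, hm2]
      · exact (h1 χ hχ).trans (Set.subset_union_left.trans (Set.subset_insert _ _))
      · exact (h2 χ hχ).trans (Set.subset_union_right.trans (Set.subset_insert _ _))
    | .box α φ => by
      have h1 := α.needs_subset_closure φ
      have h2 := φ.needs_subset_closure
      have hm := φ.mem_closure
      simp only [Form.closure, Set.mem_union]
      rintro χ (hχ | hχ)
      · refine (h1 χ hχ).trans (Set.insert_subset ?_ Set.subset_union_left)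
        exact .inr hm
      · exact (h2 χ hχ).trans Set.subset_union_right
  -- The part coming from α need not contain φ, hence the `insert`. For α;β the extra formula of the
  -- α-part is [β]φ, supplied by the β-part; for α* it is [α*]φ itself.
  theorem Prog.needs_subset_closure : ∀ (α : Prog Atm Var) (φ : Form Atm Var),
      ∀ χ ∈ α.closure φ, χ.needs ⊆ insert φ (α.closure φ)
    | .atom a, φ => by simp [Prog.closure, Form.needs]
    | .test ψ, φ => by
      have h := ψ.needs_subset_closure
      have hm := ψ.mem_closure
      simp only [Prog.closure, Set.mem_insert_iff]
      rintro χ (rfl | hχ)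
      · simp [Form.needs, Set.insert_subset_iff, hm]
      · exact (h χ hχ).trans ((Set.subset_insert _ _).trans (Set.subset_insert _ _))
    | .seq α β, φ => by
      have h1 := α.needs_subset_closure (.box β φ)
      have h2 := β.needs_subset_closure φ
      have hm1 := α.box_mem_closure (.box β φ)
      have hm2 := β.box_mem_closure φ
      simp only [Prog.closure, Set.mem_insert_iff, Set.mem_union]
      rintro χ (rfl | hχ | hχ)
      · simp [Form.needs, Set.insert_subset_iff, hm1]
      · refine (h1 χ hχ).trans (Set.insert_subset ?_ fun ρ hρ => ?_) <;> simp [*]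
      · refine (h2 χ hχ).trans (Set.insert_subset ?_ fun ρ hρ => ?_) <;> simp [*]
    | .union α β, φ => by
      have h1 := α.needs_subset_closure φ
      have h2 := β.needs_subset_closure φ
      have hm1 := α.box_mem_closure φ
      have hm2 := β.box_mem_closure φ
      simp only [Prog.closure, Set.mem_insert_iff, Set.mem_union]
      rintro χ (rfl | hχ | hχ)
      · simp [Form.needs, Set.insert_subset_iff, hm1, hm2]
      · refine (h1 χ hχ).trans (Set.insert_subset ?_ fun ρ hρ => ?_) <;> simp [*]
      · refine (h2 χ hχ).trans (Set.insert_subset ?_ fun ρ hρ => ?_) <;> simp [*]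
    | .star α, φ => by
      have h := α.needs_subset_closure (.box (.star α) φ)
      have hm := α.box_mem_closure (.box (.star α) φ)
      simp only [Prog.closure, Set.mem_insert_iff]
      rintro χ (rfl | hχ)
      · simp [Form.needs, Set.insert_subset_iff, hm]
      · refine (h χ hχ).trans (Set.subset_insert _ _)
end

/-! ### Filtration -/

/-- A surjection of the canonical worlds onto a finite type that identifies two worlds exactly
when they agree on `Γ`. -/
structure IsFiltration (Γ : Set (Form Atm Var)) {X : Type w}
    (c : CanonicalWorld n Atm Var → X) : Prop where
  finite : Γ.Finite
  closed : ∀ φ ∈ Γ, φ.needs ⊆ Γ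
  surjective : Function.Surjective c
  finite_target : Finite X
  eq_iff : ∀ x y, c x = c y ↔ ∀ φ ∈ Γ, x.val φ = y.val φ

theorem exists_isFiltration {Γ : Set (Form Atm Var)} (hΓ : Γ.Finite)
    (hc : ∀ φ ∈ Γ, φ.needs ⊆ Γ) :
    ∃ (X : Type w) (c : CanonicalWorld n Atm Var → X), IsFiltration Γ c := by
  have : Finite Γ := hΓ
  have : Finite (Luk n) := (finite_Luk n).to_subtype
  let r : CanonicalWorld n Atm Var → Γ → Luk n := fun x φ => ⟨x.val φ, x.isValuation.mem φ⟩
  obtain ⟨k, ⟨g⟩⟩ := Finite.exists_equiv_fin (Set.range r)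
  -- The points are the realized patterns of values on Γ, numbered and lifted to the universe of the
  -- worlds.
  refine ⟨ULift (Fin k), fun x => ⟨g (Set.rangeFactorization r x)⟩, hΓ, hc, ?_, inferInstance,
    fun x y => ?_⟩
  · exact ULift.up_surjective.comp (g.surjective.comp Set.rangeFactorization_surjective)
  · rw [ULift.up_inj, g.injective.eq_iff, Set.rangeFactorization_eq_rangeFactorization_iff,
      funext_iff]
    simp [r]

namespace IsFiltration

variable {Γ : Set (Form Atm Var)} {X : Type w} {c : CanonicalWorld n Atm Var → X}

/-- The filtrated model. -/
noncomputable abbrev model (hc : IsFiltration Γ c) [Nonempty X] :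
    KripkeModel.{u, v, w} n Atm Var where
  World := X
  nonempty := inferInstance
  -- The smallest filtration: some representatives are related. The values of variables come from an
  -- arbitrary representative, a choice that is immaterial for variables in Γ.
  rel a s t := ∃ x y, c x = s ∧ c y = t ∧ CanonicalWorld.Rel (.atom a) x y
  valuation s p := (Function.surjInv hc.surjective s).val (.var p)
  valuation_mem s _ := (Function.surjInv hc.surjective s).isValuation.mem _

/-- One class is a finite intersection of level sets of formulas in Γ, and S is cut out by excluding
the finitely many classes outside it. -/
theorem isDefinable (hn : 1 ≤ n) (hc : IsFiltration Γ c) (S : Set X) :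
    IsDefinable (c ⁻¹' S) := by
  have := hc.finite_target
  have hsingle : ∀ t, IsDefinable (c ⁻¹' {t}) := by
    intro t
    obtain ⟨y, rfl⟩ := hc.surjective t
    convert IsDefinable.biInter hc.finite
      (D := fun φ => {x : CanonicalWorld n Atm Var | x.val φ = y.val φ})
      fun φ _ => IsDefinable.setOf_eq hn φ (y.isValuation.mem φ) using 1
    ext x
    simp [hc.eq_iff]
  have h := IsDefinable.biInter (Sᶜ).toFinite (D := fun t => (c ⁻¹' {t})ᶜ)
    fun t _ => (hsingle t).compl
  convert h using 1
  ext x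
  simp only [Set.mem_preimage, Set.mem_iInter, Set.mem_compl_iff, Set.mem_singleton_iff]
  exact ⟨fun h t ht hx => ht (hx ▸ h), fun h => not_not.1 fun hx => h _ hx rfl⟩

/-- The characteristic formula of the set of points of the filtration with a given property. -/
theorem exists_char (hn : 1 ≤ n) (hc : IsFiltration Γ c) (S : Set X) :
    ∃ χ : Form Atm Var, ∀ x, (c x ∈ S ↔ x.val χ = 1) ∧ (c x ∉ S ↔ x.val χ = 0) := by
  obtain ⟨χ, h⟩ := hc.isDefinable hn S
  refine ⟨χ, fun x => ⟨⟨(h x).1, fun h1 => ?_⟩, ⟨(h x).2, fun h1 h2 => ?_⟩⟩⟩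
  · by_contra h2
    exact one_ne_zero (h1.symm.trans ((h x).2 h2))
  · exact one_ne_zero (((h x).1 h2).symm.trans h1)

mutual
  theorem val_model [Infinite Var] [Nonempty X] (hn : 1 ≤ n) (hc : IsFiltration Γ c) :
      ∀ φ ∈ Γ, ∀ x, hc.model.val φ (c x) = x.val φ
    | .var p, hφ, x => by
      rw [KripkeModel.val]
      exact (hc.eq_iff _ _).1 (Function.surjInv_eq hc.surjective _) _ hφ
    | .zero, _, x => by rw [KripkeModel.val, x.isValuation.zero]
    | .neg φ, h, x => by
      rw [KripkeModel.val, x.isValuation.neg]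
      beta_reduce
      rw [val_model hn hc φ (hc.closed _ h (by simp [Form.needs]))]
    | .imp φ ψ, h, x => by
      rw [KripkeModel.val, x.isValuation.imp]
      beta_reduce
      rw [val_model hn hc φ (hc.closed _ h (by simp [Form.needs])),
        val_model hn hc ψ (hc.closed _ h (by simp [Form.needs]))]
    | .box α φ, h, x => by
      have hφ : φ ∈ Γ := hc.closed _ h (by cases α <;> simp [Form.needs])
      refine le_antisymm ?_ (hc.model.le_val_box.2 fun t ht => ?_)
      · by_contra hlt
        obtain ⟨y, hy, hlt⟩ := CanonicalWorld.exists_rel_le hn (hc.model.val_mem hn _ _)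
          (not_le.1 hlt)
        rw [← val_model hn hc φ hφ y] at hlt
        exact absurd (hc.model.le_val_box.1 le_rfl _ (progRel_of_rel hn hc α φ h x y hy))
          (not_le.2 hlt)
      · obtain ⟨y, rfl⟩ := hc.surjective t
        rw [val_model hn hc φ hφ y]
        exact val_box_le_of_progRel hn hc α φ h x y ht
  -- That [α]φ lies in Γ only serves to place the tests of α in Γ. For compound α, let χ be the
  -- characteristic formula of the points reachable from c x; the axioms give [α]χ the value 1 at x,
  -- so χ is 1 at y. This χ need not lie in Γ.
  theorem progRel_of_rel [Infinite Var] [Nonempty X] (hn : 1 ≤ n) (hc : IsFiltration Γ c) :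
      ∀ (α : Prog Atm Var) (φ : Form Atm Var), .box α φ ∈ Γ → ∀ x y, CanonicalWorld.Rel α x y →
        hc.model.progRel α (c x) (c y)
    | .atom a, φ, _, x, y, hxy => by
      rw [KripkeModel.progRel]
      exact ⟨x, y, rfl, rfl, hxy⟩
    | .test ψ, φ, h, x, y, hxy => by
      obtain ⟨h1, h2⟩ := CanonicalWorld.rel_test hn hxy
      rw [KripkeModel.progRel]
      beta_reduce
      rw [val_model hn hc ψ (hc.closed _ h (by simp [Form.needs]))]
      exact ⟨(hc.eq_iff _ _).2 fun χ _ => congrFun h2 χ, h1⟩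
    | .union α β, φ, h, x, y, hxy => by
      obtain ⟨χ, hχ⟩ := hc.exists_char hn {t | hc.model.progRel (.union α β) (c x) t}
      refine (hχ y).1.2 ((CanonicalWorld.rel_iff hn).1 hxy χ ?_)
      rw [x.val_union, CanonicalWorld.val_box_eq_one hn fun z hz => (hχ z).1.1 ?_,
        CanonicalWorld.val_box_eq_one hn fun z hz => (hχ z).1.1 ?_, min_self]
      · rw [Set.mem_ofPred_eq, KripkeModel.progRel]
        exact .inr (progRel_of_rel hn hc β φ (hc.closed _ h (by simp [Form.needs])) x z hz)
      · rw [Set.mem_ofPred_eq, KripkeModel.progRel]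
        exact .inl (progRel_of_rel hn hc α φ (hc.closed _ h (by simp [Form.needs])) x z hz)
    | .seq α β, φ, h, x, y, hxy => by
      have hα : Form.box α (.box β φ) ∈ Γ := hc.closed _ h (by simp [Form.needs])
      have hβ : Form.box β φ ∈ Γ := hc.closed _ hα (by cases α <;> simp [Form.needs])
      obtain ⟨χ, hχ⟩ := hc.exists_char hn {t | hc.model.progRel (.seq α β) (c x) t}
      refine (hχ y).1.2 ((CanonicalWorld.rel_iff hn).1 hxy χ ?_)
      rw [x.val_seq]
      refine CanonicalWorld.val_box_eq_one hn fun z hz =>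
        CanonicalWorld.val_box_eq_one hn fun z' hz' => (hχ z').1.1 ?_
      rw [Set.mem_ofPred_eq, KripkeModel.progRel]
      exact ⟨c z, progRel_of_rel hn hc α _ hα x z hz, progRel_of_rel hn hc β φ hβ z z' hz'⟩
    | .star α, φ, h, x, y, hxy => by
      have hα : Form.box α (.box (.star α) φ) ∈ Γ := hc.closed _ h (by simp [Form.needs])
      obtain ⟨χ, hχ⟩ := hc.exists_char hn {t | hc.model.progRel (.star α) (c x) t}
      -- The reachable set contains c x and is closed under canonical α-steps, so χ is invariant and
      -- the induction axiom applies; off the set χ is 0.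
      refine (hχ y).1.2 ((CanonicalWorld.rel_iff hn).1 hxy χ
        (CanonicalWorld.val_star_eq_one hn (fun z => ?_) x ((hχ x).1.1 ?_)))
      · by_cases hz : c z ∈ {t | hc.model.progRel (.star α) (c x) t}
        · rw [CanonicalWorld.val_box_eq_one hn fun z' hz' => (hχ z').1.1 ?_]
          · exact unitInterval.le_one'
          · rw [Set.mem_ofPred_eq, KripkeModel.progRel] at hz ⊢
            exact hz.tail (progRel_of_rel hn hc α _ hα z z' hz')
        · rw [(hχ z).2.1 hz]
          exact unitInterval.nonneg'
      · rw [Set.mem_ofPred_eq, KripkeModel.progRel]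
  -- A path in the quotient may change representatives between steps, which preserves the values of
  -- formulas in Γ; hence the restriction to boxes in Γ.
  theorem val_box_le_of_progRel [Infinite Var] [Nonempty X] (hn : 1 ≤ n)
      (hc : IsFiltration Γ c) :
      ∀ (α : Prog Atm Var) (φ : Form Atm Var), .box α φ ∈ Γ → ∀ x y,
        hc.model.progRel α (c x) (c y) → x.val (.box α φ) ≤ y.val φ
    | .atom a, φ, h, x, y, hxy => by
      rw [KripkeModel.progRel] at hxy
      obtain ⟨x', y', hx, hy, hxy⟩ := hxy
      rw [← (hc.eq_iff _ _).1 hx _ h,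
        ← (hc.eq_iff _ _).1 hy _ (hc.closed _ h (by simp [Form.needs]))]
      exact hxy φ
    | .test ψ, φ, h, x, y, hxy => by
      rw [KripkeModel.progRel, val_model hn hc ψ (hc.closed _ h (by simp [Form.needs]))] at hxy
      rw [x.val_test_of_eq_one hxy.2,
        (hc.eq_iff _ _).1 hxy.1 _ (hc.closed _ h (by simp [Form.needs]))]
    | .union α β, φ, h, x, y, hxy => by
      rw [KripkeModel.progRel] at hxy
      rw [x.val_union]
      rcases hxy with hxy | hxy
      · exact (min_le_left _ _).trans (val_box_le_of_progRel hn hc α φ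
          (hc.closed _ h (by simp [Form.needs])) x y hxy)
      · exact (min_le_right _ _).trans (val_box_le_of_progRel hn hc β φ
          (hc.closed _ h (by simp [Form.needs])) x y hxy)
    | .seq α β, φ, h, x, y, hxy => by
      have hα : Form.box α (.box β φ) ∈ Γ := hc.closed _ h (by simp [Form.needs])
      have hβ : Form.box β φ ∈ Γ := hc.closed _ hα (by cases α <;> simp [Form.needs])
      rw [KripkeModel.progRel] at hxy
      obtain ⟨t, hxt, hty⟩ := hxy
      obtain ⟨z, rfl⟩ := hc.surjective t
      rw [x.val_seq]
      exact (val_box_le_of_progRel hn hc α _ hα x z hxt).trans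
        (val_box_le_of_progRel hn hc β φ hβ z y hty)
    | .star α, φ, h, x, y, hxy => by
      have hα : Form.box α (.box (.star α) φ) ∈ Γ := hc.closed _ h (by simp [Form.needs])
      have hstep := val_box_le_of_progRel hn hc α _ hα
      rw [KripkeModel.progRel] at hxy
      -- By unfolding, the value of [α*]φ never decreases along the path. Quantifying over all
      -- representatives z permits the changes of representative.
      have key : ∀ t, Relation.ReflTransGen (hc.model.progRel α) (c x) t → ∀ z, c z = t →
          x.val (.box (.star α) φ) ≤ z.val (.box (.star α) φ) := by
        intro t ht
        induction ht with
        | refl => exact fun z hz => ((hc.eq_iff _ _).1 hz _ h).ge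
        | @tail s t _ hst ih =>
          rintro z rfl
          obtain ⟨z', rfl⟩ := hc.surjective s
          refine (ih z' rfl).trans (le_trans ?_ (hstep z' z hst))
          rw [z'.val_star α φ]
          exact min_le_right _ _
      refine (key _ hxy y rfl).trans ?_
      rw [y.val_star]
      exact min_le_left _ _
end

end IsFiltration

/-- A formula outside `PDL` is refuted in a finite model. -/
theorem exists_model_val_ne_one [Infinite Var] (hn : 1 ≤ n) {φ : Form Atm Var}
    (hφ : φ ∉ PDL n Atm Var) :
    ∃ (M : KripkeModel.{u, v, w} n Atm Var) (x : M.World), M.val φ x ≠ 1 := by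
  rw [mem_PDL_iff hn] at hφ
  push Not at hφ
  obtain ⟨x, hx⟩ := hφ
  obtain ⟨X, c, hc⟩ := exists_isFiltration.{u, v, w} (n := n) φ.finite_closure
    φ.needs_subset_closure
  have : Nonempty X := ⟨c x⟩
  exact ⟨hc.model, c x, by rwa [hc.val_model hn φ φ.mem_closure]⟩

end ManyValuedPDL

-- Soundness and completeness

theorem theorem5 (n : ℕ) (hn : 1 ≤ n)
    {Atm : Type u} [Nonempty Atm] {Var : Type v} [Countable Var] [Infinite Var]
    (φ : ManyValuedPDL.Form Atm Var) :
    φ ∈ ManyValuedPDL.PDL n Atm Var ↔ ManyValuedPDL.IsTautology.{u, v, w} n φ := by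
  constructor
  · exact fun h =>
      (ManyValuedPDL.PDL_isLeast n Atm Var).2 (ManyValuedPDL.isDynamicLogic_setOf_isTautology hn) h
  · intro h
    by_contra hφ
    obtain ⟨M, x, hx⟩ := ManyValuedPDL.exists_model_val_ne_one.{u, v, w} hn hφ
    exact hx (h M x)
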